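/- **Setting.** An environment $\nu$ with $m\ge 1$ change points consists of a function $f:[0,1]\to\mathbb R$, $f(x)=\mu_0+\sum_{i=1}^m\Delta_i\mathbf 1_{x\ge x_i^*}$, with $0<x_1^*<\dots<x_m^*<1$ and $0<|\Delta_i|\le 1$, and of a law on $\mathbb R$ of i.i.d. noise variables $\varepsilon_t$ that are centred and 1-sub-Gaussian ($\mathbb E[\varepsilon_t]=0$ and $\mathbb E[e^{\lambda\varepsilon_t}]\le e^{\lambda^2/2}$ for all $\lambda\in\mathbb R$). Put $\vartheta_i=x_{i+1}^*-x_i^*$ for $1\le i\le m-1$, $\vartheta_0=\vartheta_m=1$, $s_i=\min(\vartheta_{i-1},\vartheta_i)$ for $1\le i\le m$, and $$H_{\mathrm{detect}}^{(m,\nu)}=\max_{1\le i\le m}\frac1{s_i\Delta_i^2},\qquad H_{\mathrm{localize}}^{(m,\nu)}=\sum_{i=1}^m\frac1{\Delta_i^2}.$$ A (possibly randomized) algorithm $\pi$ chooses at each round $t$, from its past observations, a query $x_t\in[0,1]$, observes $y_t=f(x_t)+\varepsilon_t$, decides when to stop, and, when it stops, returns $N$ real estimates $\hat x_1,\dots,\hat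 x_N$. Its budget $\mathcal T_\pi\in\mathbb N\cup\{\infty\}$ is the number of queries made before it stops. It is $(\delta,\eta,N)$-correct if, for every environment $\nu$ with $m'\ge N$ change points, with probability at least $1-\delta$ under $\nu$ it stops and there are $1\le i_1<\dots<i_N\le m'$ with $|\hat x_l-x_{i_l}^*|\le\eta$ for all $l\in\{1,\dots,N\}$. Write $\log_+(x)=\max(\log x,0)$. **Statement.** There is a numerical constant $c>0$ such that the following holds. Let $\delta\in(0,1/16)$, $\eta\in(0,1/8)$ and $m\ge1$. Let $\nu$ be an environment with $m$ change points such that $\vartheta_i>2\eta$ for all $i=2,\dots,m-1$ (in particular, any environment whose change points are all more than $2\eta$ apart), and let $\pi$ be a $(\delta,\eta,m)$-correct algorithm. Then there exists an environment $\nu'$ with $m$ change points (which may depend on $\nu$, $\pi$, $\delta$ and $\eta$) such that $$H_{\mathrm{detect}}^{(m,\nu)}\le H_{\mathrm{detect}}^{(m,\nu')}\le 4H_{\mathrm{detect}}^{(m,\nu)},\qquad \tfrac12H_{\mathrm{localize}}^{(m,\nu)}\le H_{\mathrm{localize}}^{(m,\nu')}\le H_{\mathrm{localize}}^{(m,\nu)},$$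 and $$\mathbb E_{\pi,\nu'}[\mathcal T_\pi]\ \ge\ c\left(H_{\mathrm{detect}}^{(m,\nu)}+H_{\mathrm{localize}}^{(m,\nu)}\log\frac1{4\delta}+\sum_{i=1}^m\frac1{\Delta_i^2}\log_+\!\Big(\frac{s_i}{16\eta}\Big)\right),$$ where $\Delta_i$ and $s_i$ are those of $\nu$. -/

import Mathlib

open MeasureTheory ProbabilityTheory
open scoped ENNReal

/-- An environment with `m` change points: a piecewise constant function on `[0,1]`, given by its
baseline level, the positions `0 < x₁ < ⋯ < x_m < 1` of its discontinuities and its nonzero jumps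
(bounded by one), together with the common law of the i.i.d. centred 1-sub-Gaussian noise.
The `i`-th change point (`1 ≤ i ≤ m`) has index `i - 1` in `Fin m`. -/
structure CPEnvironment (m : ℕ) where
  baseline : ℝ
  pos : Fin m → ℝ
  pos_strictMono : StrictMono pos
  pos_mem : ∀ i, pos i ∈ Set.Ioo (0 : ℝ) 1
  jump : Fin m → ℝ
  jump_ne_zero : ∀ i, jump i ≠ 0
  abs_jump_le_one : ∀ i, |jump i| ≤ 1
  noise : Measure ℝ
  noise_prob : IsProbabilityMeasure noise
  noise_mean : ∫ e, e ∂noise = 0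
  noise_subgaussian : HasSubgaussianMGF (fun e : ℝ => e) 1 noise

attribute [instance] CPEnvironment.noise_prob

namespace CPEnvironment

variable {m : ℕ}

/-- The unknown function `f(x) = μ₀ + ∑ᵢ Δᵢ 1{x ≥ xᵢ}` on `[0,1]`. -/
noncomputable def mean (ν : CPEnvironment m) (x : unitInterval) : ℝ :=
  ν.baseline + ∑ i, if ν.pos i ≤ (x : ℝ) then ν.jump i else 0

/-- The spacings: `ϑᵢ = x_{i+1} - xᵢ` for `1 ≤ i ≤ m - 1` (one-based indices), and
`ϑ₀ = ϑ_m = 1` by convention. Only the indices `0 ≤ i ≤ m` are used. -/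
noncomputable def spacing (ν : CPEnvironment m) (i : ℕ) : ℝ :=
  if h : 1 ≤ i ∧ i < m then ν.pos ⟨i, h.2⟩ - ν.pos ⟨i - 1, by omega⟩ else 1

/-- The local spacing `sᵢ = min(ϑ_{i-1}, ϑᵢ)` of a change point (one-based indices). -/
noncomputable def localSpacing (ν : CPEnvironment m) (i : Fin m) : ℝ :=
  min (ν.spacing i) (ν.spacing (i + 1))

/-- The energy `sᵢ Δᵢ²` of a change point. -/
noncomputable def energySq (ν : CPEnvironment m) (i : Fin m) : ℝ :=
  ν.localSpacing i * ν.jump i ^ 2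

/-- `H_detect`, the maximum over all change points of the inverse energy. -/
noncomputable def detectComplexity (ν : CPEnvironment m) : ℝ :=
  ⨆ i, 1 / ν.energySq i

/-- `H_localize` for `N` change points: the sum of `1 / Δ²` over the `N` jumps that are largest in
absolute value. -/
noncomputable def localizeComplexity (ν : CPEnvironment m) (N : ℕ) : ℝ :=
  ∑ l ∈ Finset.univ.filter (fun l : Fin m => (l : ℕ) < N),
    1 / ν.jump (Tuple.sort (fun i => -|ν.jump i|) l) ^ 2

/-- When all change points are counted, the ordering of the jumps plays no role. -/
theorem localizeComplexity_self (ν : CPEnvironment m) :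
    ν.localizeComplexity m = ∑ i, 1 / ν.jump i ^ 2 := by
  unfold localizeComplexity
  rw [Finset.filter_true_of_mem (fun l _ => l.2)]
  exact Equiv.sum_comp (Tuple.sort (fun i => -|ν.jump i|)) (fun i => 1 / ν.jump i ^ 2)

end CPEnvironment

/-- A randomized sequential algorithm that outputs `N` estimates. All internal randomness is
carried by a random seed, independent of the noise; given the seed, every decision is a
measurable function of the observations made so far (earlier queries are themselves functions
of the seed and of earlier observations). -/
structure CPAlgorithm (N : ℕ) where
  Seed : Type
  seedSpace : MeasurableSpace Seed
  seedLaw : Measure Seed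
  seedLaw_prob : IsProbabilityMeasure seedLaw
  /-- the next query after `t` observations -/
  query : (t : ℕ) → Seed × (Fin t → ℝ) → unitInterval
  measurable_query : ∀ t, Measurable (query t)
  /-- the situations in which the algorithm wants to halt after `t` observations -/
  haltSet : (t : ℕ) → Set (Seed × (Fin t → ℝ))
  measurableSet_haltSet : ∀ t, MeasurableSet (haltSet t)
  /-- the estimates returned when the algorithm halts after `t` observations -/
  estimate : (t : ℕ) → Seed × (Fin t → ℝ) → (Fin N → ℝ)
  measurable_estimate : ∀ t, Measurable (estimate t)

attribute [instance] CPAlgorithm.seedSpace CPAlgorithm.seedLaw_prob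

namespace CPAlgorithm

variable {N m : ℕ}

/-- The sample space of the interaction: the seed and the noise sequence. -/
abbrev Outcome (π : CPAlgorithm N) : Type := π.Seed × (ℕ → ℝ)

/-- The law of the interaction of `π` with `ν`: the seed is independent of the i.i.d. noise. -/
noncomputable def law (π : CPAlgorithm N) (ν : CPEnvironment m) : Measure π.Outcome :=
  π.seedLaw.prod (Measure.infinitePi fun _ : ℕ => ν.noise)

/-- The first `t` observations `y = f(x) + ε`, each query `x` being chosen by the sampling rule
from the seed and the earlier observations. -/
noncomputable def history (π : CPAlgorithm N) (ν : CPEnvironment m) (ω : π.Outcome) :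
    (t : ℕ) → (Fin t → ℝ)
  | 0 => Fin.elim0
  | t + 1 =>
      Fin.snoc (α := fun _ => ℝ) (history π ν ω t)
        (ν.mean (π.query t (ω.1, history π ν ω t)) + ω.2 t)

/-- The number of evaluations made before the algorithm halts (`⊤` if it never halts). -/
noncomputable def budget (π : CPAlgorithm N) (ν : CPEnvironment m) (ω : π.Outcome) : ℕ∞ :=
  ⨅ (t : ℕ) (_ : (ω.1, π.history ν ω t) ∈ π.haltSet t), (t : ℕ∞)

/-- The expected budget, possibly infinite. -/
noncomputable def expectedBudget (π : CPAlgorithm N) (ν : CPEnvironment m) : ℝ≥0∞ :=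
  ∫⁻ ω, (π.budget ν ω : ℝ≥0∞) ∂(π.law ν)

/-- The algorithm halts and its `N` estimates are within `η` of `N` distinct change points,
taken in increasing order. -/
def successEvent (π : CPAlgorithm N) (ν : CPEnvironment m) (η : ℝ) : Set π.Outcome :=
  {ω | ∃ t : ℕ, π.budget ν ω = t ∧ ∃ i : Fin N → Fin m, StrictMono i ∧
    ∀ l, |π.estimate t (ω.1, π.history ν ω t) l - ν.pos (i l)| ≤ η}

/-- `(δ, η, N)`-correctness: success with probability at least `1 - δ` in every environment with
at least `N` change points. -/
def IsCorrect (π : CPAlgorithm N) (δ η : ℝ) : Prop :=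
  ∀ m : ℕ, N ≤ m → ∀ ν : CPEnvironment m,
    ENNReal.ofReal (1 - δ) ≤ π.law ν (π.successEvent ν η)

end CPAlgorithm

/-! Only Gaussian noise is needed. Each of the three terms is a lower bound in some environment
comparable to `ν`; since `ν'` may depend on everything, the dominant term decides which one is
taken, and the sum costs only a constant factor.

All three bounds rest on one comparison of laws. When the unknown function is g, the first n
observations have an explicit density p_g with respect to pure noise, and p_g² = p_h · p_{2g-h} ·
e^V, where V is the sum of (g - h)² over the queries. By AM-GM, P_g(C) ≤ (λ/2) P_h(C) + e^K/(2λ) for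
every event C decided while V ≤ K (`traceLaw_iUnion_le`). An event that is likely under g and
unlikely under h thus forces many queries where g and h differ. No log-likelihood is averaged, so no
integrability of the halting time is required.

Confidence (`exists_confidence_cost`): moving one change point by more than 2η makes the two success
events disjoint, so of order log(1/(4δ))/Δ² queries must fall between the old and the new position.
Moves in a common direction use disjoint regions, so these costs add up.

Search (`exists_search_cost`): each change point is hidden among about s_i/(16η) positions of its
own window. Averaging over the product of these grids gives one environment in which the windows are
expensive all together.

Detection (`exists_detection_cost`): the point of least energy and its nearest neighbour become a
bump of width s, hidden in one of about 1/(16s) places. The function without the bump has too few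
change points for correctness to constrain the algorithm there. But under it, one of two well
separated zones contains the first estimate with probability at most 1/2, and the bump is hidden in
that zone. -/

/-! ### Gaussian change of measure for adaptively chosen queries. -/

/-- One step of the change of measure: exp(ce - c²/2) is the ratio of the densities of N(c, 1) and
N(0, 1). -/
theorem lintegral_gaussianReal_add (c : ℝ) (F : ℝ → ℝ≥0∞) (hF : Measurable F) :
    ∫⁻ e, F (c + e) ∂gaussianReal 0 1
      = ∫⁻ e, F e * ENNReal.ofReal (Real.exp (c * e - c ^ 2 / 2)) ∂gaussianReal 0 1 := by
  have h1 : ∫⁻ e, F (c + e) ∂gaussianReal 0 1 = ∫⁻ e, F e ∂gaussianReal c 1 := by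
    have := gaussianReal_map_const_add (μ := 0) (v := 1) c
    rw [zero_add] at this
    rw [← this, lintegral_map hF (by fun_prop)]
  rw [h1, gaussianReal_of_var_ne_zero _ one_ne_zero, gaussianReal_of_var_ne_zero _ one_ne_zero,
    lintegral_withDensity_eq_lintegral_mul _ (measurable_gaussianPDF _ _) hF,
    lintegral_withDensity_eq_lintegral_mul _ (measurable_gaussianPDF _ _) (by fun_prop)]
  refine lintegral_congr fun e => ?_
  have : gaussianPDF c 1 e
      = gaussianPDF 0 1 e * ENNReal.ofReal (Real.exp (c * e - c ^ 2 / 2)) := by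
    simp only [gaussianPDF]
    rw [← ENNReal.ofReal_mul (gaussianPDFReal_nonneg _ _ _)]
    congr 1
    simp only [gaussianPDFReal]
    rw [mul_assoc (_⁻¹), ← Real.exp_add]
    congr 2
    push_cast
    ring
  simp only [Pi.mul_apply, this]
  ring

namespace CPAlgorithm

variable {N : ℕ} (π : CPAlgorithm N)

/-- The law of the seed and of a sequence of independent standard Gaussian variables. -/
noncomputable def gaussianLaw : Measure π.Outcome :=
  π.seedLaw.prod (Measure.infinitePi fun _ : ℕ => gaussianReal 0 1)

instance : IsProbabilityMeasure π.gaussianLaw := by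
  unfold gaussianLaw; infer_instance

/-- The seed and the first `n` terms of the sequence. -/
def trunc (n : ℕ) (ω : π.Outcome) : π.Seed × (Fin n → ℝ) := (ω.1, fun i => ω.2 i)

@[fun_prop]
theorem measurable_trunc (n : ℕ) : Measurable (π.trunc n) := by
  unfold trunc; fun_prop

/-- Append a term to a finite history. -/
def extend (n : ℕ) (p : (π.Seed × (Fin n → ℝ)) × ℝ) : π.Seed × (Fin (n + 1) → ℝ) :=
  (p.1.1, Fin.snoc (α := fun _ => ℝ) p.1.2 p.2)

@[fun_prop]
theorem measurable_extend (n : ℕ) : Measurable (π.extend n) := by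
  unfold extend
  refine Measurable.prodMk (by fun_prop) (measurable_pi_lambda _ fun i => ?_)
  refine Fin.lastCases ?_ (fun j => ?_) i
  · simp only [Fin.snoc_last]; fun_prop
  · simp only [Fin.snoc_castSucc]; fun_prop

theorem extend_trunc (n : ℕ) (ω : π.Outcome) :
    π.extend n (π.trunc n ω, ω.2 n) = π.trunc (n + 1) ω := by
  unfold extend trunc
  ext i
  · rfl
  · refine Fin.lastCases ?_ (fun j => ?_) i <;> simp

/-- The next term of the noise is independent of the past. -/
theorem lintegral_gaussianLaw_next (n : ℕ) (F : (π.Seed × (Fin n → ℝ)) × ℝ → ℝ≥0∞)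
    (hF : Measurable F) :
    ∫⁻ ω, F (π.trunc n ω, ω.2 n) ∂π.gaussianLaw
      = ∫⁻ ω, ∫⁻ e, F (π.trunc n ω, e) ∂gaussianReal 0 1 ∂π.gaussianLaw := by
  set Q : Measure (ℕ → ℝ) := Measure.infinitePi fun _ : ℕ => gaussianReal 0 1 with hQ
  have hind : IndepFun (fun (y : ℕ → ℝ) (i : Fin n) => y i) (fun y : ℕ → ℝ => y n) Q := by
    have h0 : iIndepFun (fun (i : ℕ) (y : ℕ → ℝ) => y i) Q :=
      iIndepFun_infinitePi (X := fun _ y => y) (by fun_prop)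
    have h1 := h0.indepFun_finset (Finset.range n) {n} (by simp) (by fun_prop)
    exact h1.comp (φ := fun (z : Finset.range n → ℝ) (i : Fin n) =>
        z ⟨i, Finset.mem_range.2 i.2⟩) (ψ := fun z : ({n} : Finset ℕ) → ℝ => z ⟨n, by simp⟩)
      (by fun_prop) (by fun_prop)
  have hmap := (indepFun_iff_map_prod_eq_prod_map_map
    (Measurable.aemeasurable (by fun_prop)) (Measurable.aemeasurable (by fun_prop))).1 hind
  have hev : Q.map (fun y : ℕ → ℝ => y n) = gaussianReal 0 1 :=
    Measure.infinitePi_map_eval (μ := fun _ : ℕ => gaussianReal 0 1) n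
  rw [hev] at hmap
  unfold gaussianLaw
  rw [← hQ, lintegral_prod _ (by fun_prop), lintegral_prod _ (by
    refine Measurable.aemeasurable ?_
    exact (Measurable.lintegral_prod_right' (ν := gaussianReal 0 1)
      (f := fun p : π.Outcome × ℝ => F (π.trunc n p.1, p.2)) (by fun_prop)))]
  refine lintegral_congr fun s => ?_
  have h2 : ∫⁻ y, F (π.trunc n (s, y), y n) ∂Q
      = ∫⁻ p, F ((s, p.1), p.2) ∂(Q.map fun y => (fun i : Fin n => y i, y n)) := by
    rw [lintegral_map (by fun_prop) (by fun_prop)]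
    rfl
  have : IsProbabilityMeasure (Q.map fun (y : ℕ → ℝ) (i : Fin n) => y i) :=
    Measure.isProbabilityMeasure_map (Measurable.aemeasurable (by fun_prop))
  rw [h2, hmap, lintegral_prod _ (by fun_prop), lintegral_map _ (by fun_prop)]
  · rfl
  · exact (Measurable.lintegral_prod_right' (ν := gaussianReal 0 1)
      (f := fun p : (Fin n → ℝ) × ℝ => F ((s, p.1), p.2)) (by fun_prop))

/-- The first `t` observations when the unknown function is `g`. -/
noncomputable def trajectory (g : unitInterval → ℝ) (ω : π.Outcome) : (t : ℕ) → (Fin t → ℝ)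
  | 0 => Fin.elim0
  | t + 1 =>
      Fin.snoc (α := fun _ => ℝ) (trajectory g ω t)
        (g (π.query t (ω.1, trajectory g ω t)) + ω.2 t)

theorem history_eq_trajectory {m : ℕ} (ν : CPEnvironment m) (ω : π.Outcome) (t : ℕ) :
    π.history ν ω t = π.trajectory ν.mean ω t := by
  induction t with
  | zero => rfl
  | succ t ih => simp only [history, trajectory, ih]

/-- The seed together with the whole sequence of observations when the unknown function is `g`. -/
noncomputable def play (g : unitInterval → ℝ) (ω : π.Outcome) : π.Outcome :=
  (ω.1, fun t => π.trajectory g ω (t + 1) (Fin.last t))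

theorem trunc_play (g : unitInterval → ℝ) (ω : π.Outcome) (n : ℕ) :
    π.trunc n (π.play g ω) = (ω.1, π.trajectory g ω n) := by
  unfold trunc play
  refine Prod.ext rfl ?_
  induction n with
  | zero => ext i; exact i.elim0
  | succ n ih =>
    funext i
    refine Fin.lastCases rfl (fun j => ?_) i
    have := congrFun ih j
    simp only [Fin.val_castSucc] at this ⊢
    rw [this]
    simp [trajectory]

theorem measurable_trajectory {g : unitInterval → ℝ} (hg : Measurable g) (n : ℕ) :
    Measurable fun ω : π.Outcome => (ω.1, π.trajectory g ω n) := by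
  induction n with
  | zero =>
    refine Measurable.prodMk (by fun_prop) (measurable_pi_lambda _ fun i => i.elim0)
  | succ n ih =>
    have h := π.measurable_query n
    have : (fun ω : π.Outcome => (ω.1, π.trajectory g ω (n + 1)))
        = fun ω => π.extend n ((ω.1, π.trajectory g ω n),
            g (π.query n (ω.1, π.trajectory g ω n)) + ω.2 n) := rfl
    rw [this]
    have h2 : Measurable fun ω : π.Outcome => g (π.query n (ω.1, π.trajectory g ω n)) :=
      hg.comp (h.comp ih)
    fun_prop

@[fun_prop]
theorem measurable_play {g : unitInterval → ℝ} (hg : Measurable g) : Measurable (π.play g) := by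
  unfold play
  refine Measurable.prodMk (by fun_prop) (measurable_pi_lambda _ fun t => ?_)
  exact (measurable_pi_apply (Fin.last t)).comp
    (measurable_snd.comp (π.measurable_trajectory hg (t + 1)))

/-- The law of the seed and the observations when the unknown function is `g` and the noise is
standard Gaussian. -/
noncomputable def traceLaw (g : unitInterval → ℝ) : Measure π.Outcome :=
  π.gaussianLaw.map (π.play g)

theorem isProbabilityMeasure_traceLaw {g : unitInterval → ℝ} (hg : Measurable g) :
    IsProbabilityMeasure (π.traceLaw g) :=
  Measure.isProbabilityMeasure_map (π.measurable_play hg).aemeasurable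

/-- The query following the first `t` observations. -/
noncomputable def nextQuery (t : ℕ) (ω : π.Outcome) : unitInterval := π.query t (π.trunc t ω)

@[fun_prop]
theorem measurable_nextQuery (t : ℕ) : Measurable (π.nextQuery t) :=
  (π.measurable_query t).comp (π.measurable_trunc t)

/-- The log-likelihood of `g` after `n` observations, relative to the zero function. -/
noncomputable def logLikelihood (g : unitInterval → ℝ) (n : ℕ) (ω : π.Outcome) : ℝ :=
  ∑ t ∈ Finset.range n, (g (π.nextQuery t ω) * ω.2 t - g (π.nextQuery t ω) ^ 2 / 2)

theorem measurable_logLikelihood {g : unitInterval → ℝ} (hg : Measurable g) (n : ℕ) :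
    Measurable (π.logLikelihood g n) := by
  unfold logLikelihood
  refine Finset.measurable_sum _ fun t _ => ?_
  have : Measurable fun ω => g (π.nextQuery t ω) := hg.comp (π.measurable_nextQuery t)
  fun_prop

/-- A section of `trunc`. -/
def pad (n : ℕ) (p : π.Seed × (Fin n → ℝ)) : π.Outcome :=
  (p.1, fun t => if h : t < n then p.2 ⟨t, h⟩ else 0)

@[fun_prop]
theorem measurable_pad (n : ℕ) : Measurable (π.pad n) := by
  unfold pad
  refine Measurable.prodMk (by fun_prop) (measurable_pi_lambda _ fun t => ?_)
  by_cases h : t < n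
  · simp only [h, dite_true]; fun_prop
  · simp only [h, dite_false]; fun_prop

theorem trunc_pad_trunc {k n : ℕ} (h : k ≤ n) (ω : π.Outcome) :
    π.trunc k (π.pad n (π.trunc n ω)) = π.trunc k ω := by
  unfold trunc pad
  refine Prod.ext rfl (funext fun i => ?_)
  simp [lt_of_lt_of_le i.2 h]

/-- Expresses the log-likelihood through the first n observations only, so that it is a constant
factor when the next one is integrated out. -/
theorem logLikelihood_pad_trunc (g : unitInterval → ℝ) (n : ℕ) (ω : π.Outcome) :
    π.logLikelihood g n (π.pad n (π.trunc n ω)) = π.logLikelihood g n ω := by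
  unfold logLikelihood
  refine Finset.sum_congr rfl fun t ht => ?_
  have ht' := Finset.mem_range.1 ht
  have h1 : π.nextQuery t (π.pad n (π.trunc n ω)) = π.nextQuery t ω := by
    unfold nextQuery; rw [trunc_pad_trunc _ ht'.le]
  rw [h1]
  simp [pad, trunc, ht']

/-- On the first `n` observations, the law of the trace has a density with respect to the law of
the noise. -/
theorem lintegral_traceLaw {g : unitInterval → ℝ} (hg : Measurable g) (n : ℕ)
    (F : π.Seed × (Fin n → ℝ) → ℝ≥0∞) (hF : Measurable F) :
    ∫⁻ ω, F (π.trunc n ω) ∂π.traceLaw g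
      = ∫⁻ ω, F (π.trunc n ω) * ENNReal.ofReal (Real.exp (π.logLikelihood g n ω))
          ∂π.gaussianLaw := by
  have hplay : ∀ k (G : π.Seed × (Fin k → ℝ) → ℝ≥0∞), Measurable G →
      ∫⁻ ω, G (π.trunc k ω) ∂π.traceLaw g
        = ∫⁻ ω, G (ω.1, π.trajectory g ω k) ∂π.gaussianLaw := by
    intro k G hG
    unfold traceLaw
    rw [lintegral_map (by fun_prop) (by fun_prop)]
    simp_rw [trunc_play]
  induction n with
  | zero =>
    rw [hplay 0 F hF]
    refine lintegral_congr fun ω => ?_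
    have : (ω.1, π.trajectory g ω 0) = π.trunc 0 ω :=
      Prod.ext rfl (funext fun i => i.elim0)
    simp [this, logLikelihood]
  | succ n ih =>
    have hq : Measurable fun p : π.Seed × (Fin n → ℝ) => g (π.query n p) :=
      hg.comp (π.measurable_query n)
    have hq' : Measurable fun z : (π.Seed × (Fin n → ℝ)) × ℝ => g (π.query n z.1) :=
      hq.comp measurable_fst
    set F' : π.Seed × (Fin n → ℝ) → ℝ≥0∞ := fun p =>
      ∫⁻ e, F (π.extend n (p, e))
        * ENNReal.ofReal (Real.exp (g (π.query n p) * e - g (π.query n p) ^ 2 / 2))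
        ∂gaussianReal 0 1 with hF'
    have hmul : Measurable fun z : (π.Seed × (Fin n → ℝ)) × ℝ => F (π.extend n z)
        * ENNReal.ofReal (Real.exp (g (π.query n z.1) * z.2 - g (π.query n z.1) ^ 2 / 2)) := by
      refine (hF.comp (π.measurable_extend n)).mul (Measurable.ennreal_ofReal ?_)
      exact ((hq'.mul measurable_snd).sub ((hq'.pow_const 2).div_const 2)).exp
    have hF'm : Measurable F' :=
      Measurable.lintegral_prod_right' (ν := gaussianReal 0 1)
        (f := fun z : (π.Seed × (Fin n → ℝ)) × ℝ => F (π.extend n z)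
          * ENNReal.ofReal (Real.exp (g (π.query n z.1) * z.2 - g (π.query n z.1) ^ 2 / 2)))
        (hmul)
    have hA : ∫⁻ ω, F (π.trunc (n + 1) ω) ∂π.traceLaw g
        = ∫⁻ ω, F' (π.trunc n ω) ∂π.traceLaw g := by
      rw [hplay _ F hF, hplay _ F' hF'm]
      -- The first n observations depend on the first n noise terms only, so they stay fixed while
      -- the next noise term, independent of them, is averaged and shifted.
      have hpull : ∀ ω : π.Outcome,
          π.trajectory g ω n = π.trajectory g (π.pad n (π.trunc n ω)) n := by
        have key : ∀ (ω : π.Outcome) (k : ℕ), k ≤ n →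
            π.trajectory g ω k = π.trajectory g (π.pad n (π.trunc n ω)) k := by
          intro ω k
          induction k with
          | zero => intro _; rfl
          | succ k ihk =>
            intro hk
            have hk' : k < n := hk
            simp only [trajectory]
            rw [← ihk (by omega)]
            simp [pad, trunc, hk']
        exact fun ω => key ω n le_rfl
      have hm : Measurable fun p : π.Seed × (Fin n → ℝ) =>
          (p.1, π.trajectory g (π.pad n p) n) :=
        (π.measurable_trajectory hg n).comp (π.measurable_pad n)
      have h1 := π.lintegral_gaussianLaw_next n
        (fun z => F (π.extend n ((z.1.1, π.trajectory g (π.pad n z.1) n),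
          g (π.query n (z.1.1, π.trajectory g (π.pad n z.1) n)) + z.2)))
        (by
          have : Measurable fun z : (π.Seed × (Fin n → ℝ)) × ℝ =>
              (z.1.1, π.trajectory g (π.pad n z.1) n) := hm.comp measurable_fst
          have h3 := hq.comp this
          exact hF.comp ((π.measurable_extend n).comp
            (this.prodMk (h3.add measurable_snd))))
      calc ∫⁻ ω, F (ω.1, π.trajectory g ω (n + 1)) ∂π.gaussianLaw
          = ∫⁻ ω, F (π.extend n ((ω.1, π.trajectory g (π.pad n (π.trunc n ω)) n),
              g (π.query n (ω.1, π.trajectory g (π.pad n (π.trunc n ω)) n)) + ω.2 n))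
              ∂π.gaussianLaw := by
            refine lintegral_congr fun ω => ?_
            rw [← hpull]; rfl
        _ = _ := h1
        _ = _ := by
            refine lintegral_congr fun ω => ?_
            simp only [trunc]
            have := hpull ω
            simp only [trunc] at this
            rw [← this]
            rw [lintegral_gaussianReal_add _
              (fun e => F (π.extend n ((ω.1, π.trajectory g ω n), e))) (by fun_prop)]
    have hB := π.lintegral_gaussianLaw_next n
      (fun z => F (π.extend n z)
          * ENNReal.ofReal (Real.exp (g (π.query n z.1) * z.2 - g (π.query n z.1) ^ 2 / 2))
          * ENNReal.ofReal (Real.exp (π.logLikelihood g n (π.pad n z.1))))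
      (hmul.mul (Measurable.ennreal_ofReal
        ((π.measurable_logLikelihood hg n).comp ((π.measurable_pad n).comp measurable_fst)).exp))
    rw [hA, ih F' hF'm]
    calc _ = ∫⁻ ω, ∫⁻ e, F (π.extend n (π.trunc n ω, e))
            * ENNReal.ofReal (Real.exp (g (π.query n (π.trunc n ω)) * e
              - g (π.query n (π.trunc n ω)) ^ 2 / 2))
            * ENNReal.ofReal (Real.exp (π.logLikelihood g n ω)) ∂gaussianReal 0 1
            ∂π.gaussianLaw := by
          refine lintegral_congr fun ω => ?_
          rw [hF']
          exact (lintegral_mul_const _ (by fun_prop)).symm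
      _ = _ := by
          simp_rw [logLikelihood_pad_trunc] at hB
          exact hB.symm
      _ = _ := by
          refine lintegral_congr fun ω => ?_
          rw [extend_trunc, mul_assoc, ← ENNReal.ofReal_mul (by positivity), ← Real.exp_add]
          congr 3
          rw [logLikelihood, logLikelihood, Finset.sum_range_succ, add_comm]
          rfl

end CPAlgorithm

/-! ### Comparison of two laws under bounded information. -/

namespace CPAlgorithm

variable {N : ℕ} (π : CPAlgorithm N)

/-- The events decided by the seed and the first `n` observations. -/
@[reducible]
def past (n : ℕ) : MeasurableSpace π.Outcome := MeasurableSpace.comap (π.trunc n) inferInstance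

theorem past_le (n : ℕ) : π.past n ≤ (inferInstance : MeasurableSpace π.Outcome) := (π.measurable_trunc n).comap_le

theorem measurable_trunc_past {k n : ℕ} (h : k ≤ n) : Measurable[π.past n] (π.trunc k) := by
  have h1 : π.trunc k = (fun p => π.trunc k (π.pad n p)) ∘ π.trunc n := by
    funext ω; exact (π.trunc_pad_trunc h ω).symm
  rw [h1]
  exact Measurable.comp (by fun_prop) (comap_measurable _)

theorem measurable_nextQuery_past {k n : ℕ} (h : k ≤ n) :
    Measurable[π.past n] (π.nextQuery k) :=
  (π.measurable_query k).comp (π.measurable_trunc_past h)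

/-- AM-GM applied to the factorization e^{2a} = e^b · e^{c+V}; the weight `lam` is left free so that
each application can balance the two terms. -/
theorem exp_le_weighted {a b c V K lam : ℝ} (hlam : 0 < lam) (h : 2 * a - b = c + V)
    (hV : V ≤ K) :
    Real.exp a ≤ lam / 2 * Real.exp b + Real.exp K / (2 * lam) * Real.exp c := by
  have h1 : Real.exp a ^ 2 ≤ (lam * Real.exp b) * (Real.exp K / lam * Real.exp c) := by
    have : (lam * Real.exp b) * (Real.exp K / lam * Real.exp c) = Real.exp (b + K + c) := by
      rw [Real.exp_add, Real.exp_add]; field_simp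
    rw [this, ← Real.exp_nat_mul]
    exact Real.exp_le_exp.2 (by push_cast; linarith)
  have h2 : lam / 2 * Real.exp b + Real.exp K / (2 * lam) * Real.exp c
      = (lam * Real.exp b + Real.exp K / lam * Real.exp c) / 2 := by
    field_simp
  rw [h2]
  set x := lam * Real.exp b
  set y := Real.exp K / lam * Real.exp c
  have hx : 0 < x := by positivity
  have hy : 0 < y := by positivity
  refine le_of_sq_le_sq ?_ (by positivity)
  nlinarith [sq_nonneg (x - y)]

/-- The third function is 2g - h because 2L_g - L_h = L_{2g-h} + Σ (g - h)², term by term in the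
log-likelihoods. Its law has mass at most one on any event, which is all that is used of it later.
-/
theorem traceLaw_past_le {g h : unitInterval → ℝ} (hg : Measurable g) (hh : Measurable h)
    {n : ℕ} {C : Set π.Outcome} (hC : MeasurableSet[π.past n] C) {K lam : ℝ} (hlam : 0 < lam)
    (hV : ∀ ω ∈ C, ∑ t ∈ Finset.range n,
      (g (π.nextQuery t ω) - h (π.nextQuery t ω)) ^ 2 ≤ K) :
    π.traceLaw g C ≤ ENNReal.ofReal (lam / 2) * π.traceLaw h C
      + ENNReal.ofReal (Real.exp K / (2 * lam)) * π.traceLaw (fun x => 2 * g x - h x) C := by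
  obtain ⟨B, hB, rfl⟩ := hC
  have hk : Measurable fun x => 2 * g x - h x := by fun_prop
  have key : ∀ {f : unitInterval → ℝ}, Measurable f → π.traceLaw f (π.trunc n ⁻¹' B)
      = ∫⁻ ω, B.indicator 1 (π.trunc n ω) * ENNReal.ofReal (Real.exp (π.logLikelihood f n ω))
          ∂π.gaussianLaw := by
    intro f hf
    rw [← π.lintegral_traceLaw hf n _ (measurable_one.indicator hB),
      ← lintegral_indicator_one (π.measurable_trunc n hB)]
    rfl
  rw [key hg, key hh, key hk]
  have mg := (π.measurable_logLikelihood hg n)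
  have mh := (π.measurable_logLikelihood hh n)
  have mk := (π.measurable_logLikelihood hk n)
  have mB : Measurable fun ω => B.indicator (1 : π.Seed × (Fin n → ℝ) → ℝ≥0∞) (π.trunc n ω) :=
    (measurable_one.indicator hB).comp (π.measurable_trunc n)
  rw [← lintegral_const_mul _ (by fun_prop), ← lintegral_const_mul _ (by fun_prop),
    ← lintegral_add_left (by fun_prop)]
  refine lintegral_mono fun ω => ?_
  by_cases hω : π.trunc n ω ∈ B
  · simp only [Set.indicator_of_mem hω, Pi.one_apply, one_mul]
    rw [← ENNReal.ofReal_mul (by positivity), ← ENNReal.ofReal_mul (by positivity),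
      ← ENNReal.ofReal_add (by positivity) (by positivity)]
    refine ENNReal.ofReal_le_ofReal (exp_le_weighted hlam ?_ (hV ω hω))
    unfold logLikelihood
    rw [Finset.mul_sum, ← Finset.sum_sub_distrib, ← Finset.sum_add_distrib]
    exact Finset.sum_congr rfl fun t _ => by ring
  · simp [Set.indicator_of_notMem hω]

/-- Comparison of two laws on an event that is decided while the accumulated information is
bounded. -/
theorem traceLaw_iUnion_le {g h : unitInterval → ℝ} (hg : Measurable g) (hh : Measurable h)
    {C : ℕ → Set π.Outcome} (hC : ∀ n, MeasurableSet[π.past n] (C n))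
    (hdisj : Pairwise (Function.onFun Disjoint C)) {K lam : ℝ} (hlam : 0 < lam)
    (hV : ∀ n, ∀ ω ∈ C n, ∑ t ∈ Finset.range n,
      (g (π.nextQuery t ω) - h (π.nextQuery t ω)) ^ 2 ≤ K) :
    π.traceLaw g (⋃ n, C n) ≤ ENNReal.ofReal (lam / 2) * π.traceLaw h (⋃ n, C n)
      + ENNReal.ofReal (Real.exp K / (2 * lam)) := by
  have hm : ∀ n, MeasurableSet (C n) := fun n => π.past_le n _ (hC n)
  have hk : Measurable fun x => 2 * g x - h x := by fun_prop
  have := π.isProbabilityMeasure_traceLaw hk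
  calc π.traceLaw g (⋃ n, C n) = ∑' n, π.traceLaw g (C n) := measure_iUnion hdisj hm
    _ ≤ ∑' n, (ENNReal.ofReal (lam / 2) * π.traceLaw h (C n)
      + ENNReal.ofReal (Real.exp K / (2 * lam)) * π.traceLaw (fun x => 2 * g x - h x) (C n)) :=
        ENNReal.tsum_le_tsum fun n => π.traceLaw_past_le hg hh (hC n) hlam (hV n)
    _ = ENNReal.ofReal (lam / 2) * π.traceLaw h (⋃ n, C n)
      + ENNReal.ofReal (Real.exp K / (2 * lam))
        * π.traceLaw (fun x => 2 * g x - h x) (⋃ n, C n) := by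
        rw [ENNReal.tsum_add, ENNReal.tsum_mul_left, ENNReal.tsum_mul_left,
          measure_iUnion hdisj hm, measure_iUnion hdisj hm]
    _ ≤ _ := by
        gcongr
        exact mul_le_of_le_one_right' prob_le_one

/-! ### Halting time, visits to a region, and events decided on halting. -/

/-- The number of observations made before halting. -/
noncomputable def duration (ω : π.Outcome) : ℕ∞ :=
  ⨅ (t : ℕ) (_ : π.trunc t ω ∈ π.haltSet t), (t : ℕ∞)

theorem lt_duration_iff (ω : π.Outcome) (t : ℕ) :
    (t : ℕ∞) < π.duration ω ↔ ∀ k ≤ t, π.trunc k ω ∉ π.haltSet k := by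
  unfold duration
  constructor
  · intro h k hk hmem
    have : (⨅ (t : ℕ) (_ : π.trunc t ω ∈ π.haltSet t), (t : ℕ∞)) ≤ k := iInf₂_le k hmem
    exact absurd (lt_of_lt_of_le h (this.trans (by exact_mod_cast hk))) (lt_irrefl _)
  · intro h
    refine lt_of_lt_of_le (b := ((t + 1 : ℕ) : ℕ∞)) (by exact_mod_cast Nat.lt_succ_self t) ?_
    refine le_iInf₂ fun k hk => ?_
    have : t < k := by
      by_contra hc
      exact h k (not_lt.1 hc) hk
    exact_mod_cast this

theorem measurableSet_lt_duration {t n : ℕ} (h : t ≤ n) :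
    MeasurableSet[π.past n] {ω | (t : ℕ∞) < π.duration ω} := by
  simp only [lt_duration_iff]
  have : {ω | ∀ k ≤ t, π.trunc k ω ∉ π.haltSet k}
      = ⋂ k ∈ Finset.range (t + 1), (π.trunc k ⁻¹' π.haltSet k)ᶜ := by
    ext ω; simp
  rw [this]
  refine Finset.measurableSet_biInter _ fun k hk => ?_
  have hk' : k ≤ t := Nat.lt_succ_iff.1 (Finset.mem_range.1 hk)
  exact (π.measurable_trunc_past (hk'.trans h) (π.measurableSet_haltSet k)).compl

theorem duration_eq_iff (ω : π.Outcome) (n : ℕ) :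
    π.duration ω = n ↔ ¬ ((n : ℕ∞) < π.duration ω) ∧ ∀ k < n, (k : ℕ∞) < π.duration ω := by
  constructor
  · intro h; rw [h]; exact ⟨lt_irrefl _, fun k hk => by exact_mod_cast hk⟩
  · rintro ⟨h1, h2⟩
    refine le_antisymm (not_lt.1 h1) ?_
    rcases n with _ | n
    · simp
    · have := h2 n (Nat.lt_succ_self n)
      have h3 := Order.add_one_le_of_lt this
      exact_mod_cast h3

theorem measurableSet_duration_eq (n : ℕ) :
    MeasurableSet[π.past n] {ω | π.duration ω = n} := by
  have : {ω | π.duration ω = n} = {ω | (n : ℕ∞) < π.duration ω}ᶜ ∩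
      ⋂ k ∈ Finset.range n, {ω | (k : ℕ∞) < π.duration ω} := by
    ext ω; simp [duration_eq_iff]
  rw [this]
  exact (π.measurableSet_lt_duration le_rfl).compl.inter
    (Finset.measurableSet_biInter _ fun k hk =>
      π.measurableSet_lt_duration (Finset.mem_range.1 hk).le)

open Classical in
/-- The number of the first `n` queries that fall in `J`. -/
noncomputable def count (J : Set unitInterval) (n : ℕ) (ω : π.Outcome) : ℕ :=
  ((Finset.range n).filter fun t => π.nextQuery t ω ∈ J).card

open Classical in
/-- The number of queries made in `J` before halting. -/
noncomputable def visits (J : Set unitInterval) (ω : π.Outcome) : ℝ≥0∞ :=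
  ∑' t : ℕ, if (t : ℕ∞) < π.duration ω ∧ π.nextQuery t ω ∈ J then 1 else 0

theorem visits_eq_count (J : Set unitInterval) {ω : π.Outcome} {n : ℕ} (h : π.duration ω = n) :
    π.visits J ω = π.count J n ω := by
  classical
  unfold visits count
  rw [tsum_eq_sum (s := Finset.range n)]
  · rw [Finset.card_filter]
    push_cast
    refine Finset.sum_congr rfl fun t ht => ?_
    have : (t : ℕ∞) < π.duration ω := by rw [h]; exact_mod_cast Finset.mem_range.1 ht
    simp [this]
  · intro t ht
    have : ¬ (t : ℕ∞) < π.duration ω := by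
      rw [h]; exact_mod_cast fun hc => ht (Finset.mem_range.2 hc)
    simp [this]

theorem visits_univ (ω : π.Outcome) : π.visits Set.univ ω = (π.duration ω : ℝ≥0∞) := by
  classical
  rcases h : π.duration ω with _ | n
  · have h' : π.duration ω = ⊤ := h
    change π.visits Set.univ ω = ⊤
    unfold visits
    simp [h']
  · have h' : π.duration ω = n := h
    rw [visits_eq_count π _ h']
    simp [count]
    rfl

theorem measurable_visits {J : Set unitInterval} (hJ : MeasurableSet J) :
    Measurable (π.visits J) := by
  unfold visits
  refine Measurable.tsum fun t => Measurable.ite ?_ measurable_const measurable_const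
  exact (π.past_le t _ (π.measurableSet_lt_duration le_rfl)).inter (π.measurable_nextQuery t hJ)

theorem sum_visits_le {ι : Type*} (S : Finset ι) {J : ι → Set unitInterval}
    (hJ : (S : Set ι).PairwiseDisjoint J) (ω : π.Outcome) :
    ∑ i ∈ S, π.visits (J i) ω ≤ (π.duration ω : ℝ≥0∞) := by
  classical
  rw [← visits_univ]
  unfold visits
  rw [← Summable.tsum_finsetSum fun i _ => ENNReal.summable]
  refine ENNReal.tsum_le_tsum fun t => ?_
  by_cases ht : (t : ℕ∞) < π.duration ω
  · simp only [ht, true_and, Set.mem_univ, if_true]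
    by_cases hex : ∃ i ∈ S, π.nextQuery t ω ∈ J i
    · obtain ⟨i, hi, hmem⟩ := hex
      rw [Finset.sum_eq_single_of_mem i hi]
      · simp [hmem]
      · intro j hj hji
        rw [if_neg]
        intro hmem'
        exact Set.disjoint_left.1 (hJ hi hj (Ne.symm hji)) hmem hmem'
    · push Not at hex
      rw [Finset.sum_eq_zero fun i hi => if_neg (hex i hi)]
      simp
  · simp [ht]

theorem count_mono (J : Set unitInterval) (ω : π.Outcome) : Monotone fun n => π.count J n ω := by
  classical
  intro a b hab
  exact Finset.card_le_card (Finset.filter_subset_filter _ (Finset.range_subset_range.2 hab))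

theorem count_succ_le (J : Set unitInterval) (n : ℕ) (ω : π.Outcome) :
    π.count J (n + 1) ω ≤ π.count J n ω + 1 := by
  classical
  unfold count
  rw [Finset.range_add_one, Finset.filter_insert]
  split_ifs
  · exact Finset.card_insert_le _ _
  · exact Nat.le_succ _

theorem sum_count_le {ι : Type*} (S : Finset ι) {J : ι → Set unitInterval}
    (hJ : (S : Set ι).PairwiseDisjoint J) (n : ℕ) (ω : π.Outcome) :
    ∑ i ∈ S, π.count (J i) n ω ≤ n := by
  classical
  unfold count
  rw [← Finset.card_biUnion]
  · exact (Finset.card_le_card (Finset.biUnion_subset.2 fun i _ =>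
      Finset.filter_subset _ _)).trans (Finset.card_range n).le
  · intro i hi j hj hij
    refine Finset.disjoint_left.2 fun t ht ht' => ?_
    exact Set.disjoint_left.1 (hJ hi hj hij) (Finset.mem_filter.1 ht).2
      (Finset.mem_filter.1 ht').2

theorem measurable_count_past {J : Set unitInterval} (hJ : MeasurableSet J) {k n : ℕ}
    (h : k ≤ n) : Measurable[π.past n] (π.count J k) := by
  classical
  let := π.past n
  have : π.count J k = fun ω => ∑ t ∈ Finset.range k, if π.nextQuery t ω ∈ J then 1 else 0 := by
    funext ω; unfold count; rw [Finset.card_filter]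
  rw [this]
  refine Finset.measurable_sum _ fun t ht => Measurable.ite ?_ measurable_const measurable_const
  exact π.measurable_nextQuery_past ((Finset.mem_range.1 ht).le.trans h) hJ

/-- Turns information into queries: each query inside `J` contributes at most d², the others
nothing. -/
theorem sum_sq_le_count {g h : unitInterval → ℝ} {J : Set unitInterval} {d : ℝ}
    (hgh : ∀ x ∉ J, g x = h x) (hd : ∀ x, (g x - h x) ^ 2 ≤ d ^ 2) (n : ℕ) (ω : π.Outcome) :
    ∑ t ∈ Finset.range n, (g (π.nextQuery t ω) - h (π.nextQuery t ω)) ^ 2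
      ≤ d ^ 2 * π.count J n ω := by
  classical
  unfold count
  rw [Finset.card_filter]
  push_cast
  rw [Finset.mul_sum]
  refine Finset.sum_le_sum fun t _ => ?_
  split_ifs with hmem
  · simpa using hd _
  · simp [hgh _ hmem]

/-- Comparison of two laws on an event that is decided on halting, when few queries have been
made where the two functions differ. -/
theorem traceLaw_stopped_le {g h : unitInterval → ℝ} (hg : Measurable g) (hh : Measurable h)
    {J : Set unitInterval} (hJ : MeasurableSet J) {d : ℝ} (hgh : ∀ x ∉ J, g x = h x)
    (hd : ∀ x, (g x - h x) ^ 2 ≤ d ^ 2) {A : ℕ → Set π.Outcome}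
    (hA : ∀ n, MeasurableSet[π.past n] (A n)) {v lam : ℝ} (hv : 0 ≤ v) (hlam : 0 < lam) :
    π.traceLaw g {ω | (∃ n : ℕ, π.duration ω = n ∧ ω ∈ A n)
        ∧ ENNReal.ofReal (d ^ 2) * π.visits J ω ≤ ENNReal.ofReal v}
      ≤ ENNReal.ofReal (lam / 2) * π.traceLaw h {ω | ∃ n : ℕ, π.duration ω = n ∧ ω ∈ A n}
        + ENNReal.ofReal (Real.exp v / (2 * lam)) := by
  -- The event is split according to the halting time n; the n-th piece is decided by n
  -- observations, and its information is at most v.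
  set C : ℕ → Set π.Outcome := fun n =>
    {ω | π.duration ω = n} ∩ A n ∩ {ω | d ^ 2 * (π.count J n ω : ℝ) ≤ v} with hCdef
  have hC : ∀ n, MeasurableSet[π.past n] (C n) := by
    intro n
    refine ((π.measurableSet_duration_eq n).inter (hA n)).inter ?_
    let := π.past n
    have h1 : Measurable (π.count J n) := π.measurable_count_past hJ le_rfl
    have h2 : Measurable fun ω => d ^ 2 * (π.count J n ω : ℝ) := by fun_prop
    exact h2 measurableSet_Iic
  have hdisj : Pairwise (Function.onFun Disjoint C) := by
    intro a b hab
    refine Set.disjoint_left.2 fun ω h1 h2 => hab ?_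
    have := h1.1.1.symm.trans h2.1.1
    exact_mod_cast this
  have heq : {ω | (∃ n : ℕ, π.duration ω = n ∧ ω ∈ A n)
        ∧ ENNReal.ofReal (d ^ 2) * π.visits J ω ≤ ENNReal.ofReal v} ⊆ ⋃ n, C n := by
    rintro ω ⟨⟨n, hn, hAn⟩, hvis⟩
    refine Set.mem_iUnion.2 ⟨n, ⟨hn, hAn⟩, ?_⟩
    rw [π.visits_eq_count J hn, ← ENNReal.ofReal_natCast, ← ENNReal.ofReal_mul (by positivity),
      ENNReal.ofReal_le_ofReal_iff hv] at hvis
    exact hvis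
  refine (measure_mono heq).trans ((π.traceLaw_iUnion_le hg hh hC hdisj hlam
    fun n ω hω => (π.sum_sq_le_count hgh hd n ω).trans hω.2).trans ?_)
  gcongr
  exact Set.iUnion_subset fun n ω hω => ⟨n, hω.1⟩

/-- Comparison of two laws on the event that many queries are made where the two functions
differ. -/
theorem traceLaw_count_gt_le {g h : unitInterval → ℝ} (hg : Measurable g) (hh : Measurable h)
    {J : Set unitInterval} (hJ : MeasurableSet J) {d : ℝ} (hgh : ∀ x ∉ J, g x = h x)
    (hd : ∀ x, (g x - h x) ^ 2 ≤ d ^ 2) (τ : ℕ) {v lam : ℝ} (hv : 0 ≤ v) (hlam : 0 < lam) :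
    π.traceLaw g {ω | v < d ^ 2 * (π.count J τ ω : ℝ)}
      ≤ ENNReal.ofReal (lam / 2) * π.traceLaw h {ω | v < d ^ 2 * (π.count J τ ω : ℝ)}
        + ENNReal.ofReal (Real.exp (v + d ^ 2) / (2 * lam)) := by
  -- Here n is the first time the information bound exceeds v. The comparison is made at that time
  -- rather than at `τ`, where the information could be much larger.
  set C : ℕ → Set π.Outcome := fun n =>
    {ω | n ≤ τ ∧ v < d ^ 2 * (π.count J n ω : ℝ) ∧ d ^ 2 * (π.count J (n - 1) ω : ℝ) ≤ v}
    with hCdef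
  have hcm : ∀ ω a b, a ≤ b → d ^ 2 * (π.count J a ω : ℝ) ≤ d ^ 2 * (π.count J b ω : ℝ) := by
    intro ω a b hab
    have := π.count_mono J ω hab
    have : (π.count J a ω : ℝ) ≤ π.count J b ω := by exact_mod_cast this
    exact mul_le_mul_of_nonneg_left this (sq_nonneg d)
  have hC : ∀ n, MeasurableSet[π.past n] (C n) := by
    intro n
    let := π.past n
    have h1 : Measurable (π.count J n) := π.measurable_count_past hJ le_rfl
    have h1' : Measurable (π.count J (n - 1)) := π.measurable_count_past hJ (Nat.sub_le _ _)
    have h2 : Measurable fun ω => d ^ 2 * (π.count J n ω : ℝ) := by fun_prop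
    have h2' : Measurable fun ω => d ^ 2 * (π.count J (n - 1) ω : ℝ) := by fun_prop
    exact (MeasurableSet.const _).inter ((h2 measurableSet_Ioi).inter (h2' measurableSet_Iic))
  have hdisj' : ∀ a b, a < b → Disjoint (C a) (C b) := by
    intro a b hab
    refine Set.disjoint_left.2 fun ω h1 h2 => ?_
    have := hcm ω a (b - 1) (by omega)
    linarith [h1.2.1, h2.2.2]
  have hdisj : Pairwise (Function.onFun Disjoint C) := by
    intro a b hab
    rcases lt_or_gt_of_ne hab with h | h
    · exact hdisj' a b h
    · exact (hdisj' b a h).symm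
  have heq : {ω | v < d ^ 2 * (π.count J τ ω : ℝ)} ⊆ ⋃ n, C n := by
    classical
    intro ω hω
    have hex : ∃ n, v < d ^ 2 * (π.count J n ω : ℝ) := ⟨τ, hω⟩
    refine Set.mem_iUnion.2 ⟨Nat.find hex, Nat.find_min' hex hω, Nat.find_spec hex, ?_⟩
    refine not_lt.1 (Nat.find_min hex ?_)
    -- At time zero the count vanishes and `0 ≤ v`, so the crossing time is positive and `n - 1` is
    -- a genuine predecessor.
    have : Nat.find hex ≠ 0 := by
      intro h0
      have := Nat.find_spec hex
      rw [h0] at this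
      simp [count] at this
      linarith
    omega
  refine (measure_mono heq).trans ((π.traceLaw_iUnion_le hg hh hC hdisj hlam
    (K := v + d ^ 2) fun n ω hω => (π.sum_sq_le_count hgh hd n ω).trans ?_).trans ?_)
  -- A single query overshoots the level v by at most d².
  · have h1 : (π.count J n ω : ℝ) ≤ π.count J (n - 1) ω + 1 := by
      rcases n with _ | n
      · simp [count]
      · exact_mod_cast π.count_succ_le J n ω
    have := hω.2.2
    nlinarith [sq_nonneg d]
  · gcongr
    refine Set.iUnion_subset fun n ω hω => ?_
    exact lt_of_lt_of_le hω.2.1 (hcm ω n τ hω.1)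

end CPAlgorithm

/-! ### Gaussian environments and the geometry of local spacings. -/

theorem hasSubgaussianMGF_gaussianReal : HasSubgaussianMGF (fun e : ℝ => e) 1 (gaussianReal 0 1) where
  integrable_exp_mul t := integrable_exp_mul_gaussianReal t
  mgf_le t := by
    rw [mgf_fun_id_gaussianReal]
    simp

namespace CPEnvironment

variable {m : ℕ}

/-- The environment with standard Gaussian noise, baseline zero, and prescribed positions and
jumps. -/
noncomputable def gaussian (p D : Fin m → ℝ) (hp : StrictMono p)
    (hmem : ∀ i, p i ∈ Set.Ioo (0 : ℝ) 1) (hD : ∀ i, D i ≠ 0) (hD1 : ∀ i, |D i| ≤ 1) :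
    CPEnvironment m where
  baseline := 0
  pos := p
  pos_strictMono := hp
  pos_mem := hmem
  jump := D
  jump_ne_zero := hD
  abs_jump_le_one := hD1
  noise := gaussianReal 0 1
  noise_prob := inferInstance
  noise_mean := integral_id_gaussianReal
  noise_subgaussian := hasSubgaussianMGF_gaussianReal

theorem measurable_mean (ν : CPEnvironment m) : Measurable ν.mean := by
  unfold mean
  refine Measurable.add measurable_const (Finset.measurable_sum _ fun i _ => ?_)
  exact Measurable.ite (measurable_subtype_coe measurableSet_Ici) measurable_const measurable_const

theorem spacing_le_one (ν : CPEnvironment m) (i : ℕ) : ν.spacing i ≤ 1 := by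
  unfold spacing
  split_ifs with h
  · have h1 := (ν.pos_mem ⟨i, h.2⟩).2
    have h2 := (ν.pos_mem ⟨i - 1, by omega⟩).1
    linarith
  · exact le_rfl

/-- The local spacing is the distance to the nearest other change point, capped at one. -/
theorem le_localSpacing_iff (ν : CPEnvironment m) (i : Fin m) (r : ℝ) :
    r ≤ ν.localSpacing i ↔ r ≤ 1 ∧ ∀ j, j ≠ i → r ≤ |ν.pos i - ν.pos j| := by
  have hmono := ν.pos_strictMono.monotone
  unfold localSpacing
  constructor
  · intro h
    obtain ⟨h1, h2⟩ := le_min_iff.1 h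
    refine ⟨h1.trans (ν.spacing_le_one _), fun j hj => ?_⟩
    rcases lt_or_gt_of_ne hj with hlt | hgt
    · have hlt' : (j : ℕ) < i := hlt
      have hi : 1 ≤ (i : ℕ) ∧ (i : ℕ) < m := ⟨by omega, i.2⟩
      rw [spacing, dif_pos hi] at h1
      have : ν.pos j ≤ ν.pos ⟨i - 1, by omega⟩ := hmono (Fin.mk_le_mk.2 (by omega))
      exact le_trans (by simpa using by linarith) (le_abs_self _)
    · have hgt' : (i : ℕ) < j := hgt
      have hi : 1 ≤ (i : ℕ) + 1 ∧ (i : ℕ) + 1 < m := ⟨by omega, by omega⟩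
      rw [spacing, dif_pos hi] at h2
      have : ν.pos ⟨i + 1, by omega⟩ ≤ ν.pos j := hmono (Fin.mk_le_mk.2 (by omega))
      refine le_trans ?_ (neg_le_abs _)
      simp only [Nat.add_sub_cancel, Fin.eta] at h2
      linarith
  · rintro ⟨h1, h2⟩
    refine le_min ?_ ?_
    · unfold spacing
      split_ifs with hi
      · have hlt : (⟨i - 1, by omega⟩ : Fin m) < i := Fin.mk_lt_mk.2 (by omega)
        have := h2 _ hlt.ne
        rw [abs_of_pos (sub_pos.2 (ν.pos_strictMono hlt))] at this
        exact this
      · exact h1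
    · unfold spacing
      split_ifs with hi
      · have hlt : i < (⟨i + 1, hi.2⟩ : Fin m) := Fin.mk_lt_mk.2 (by omega)
        have := h2 _ hlt.ne'
        rw [abs_of_neg (sub_neg.2 (ν.pos_strictMono hlt))] at this
        simpa using this
      · exact h1

theorem localSpacing_le_one (ν : CPEnvironment m) (i : Fin m) : ν.localSpacing i ≤ 1 :=
  ((ν.le_localSpacing_iff i _).1 le_rfl).1

theorem localSpacing_le_abs (ν : CPEnvironment m) {i j : Fin m} (h : j ≠ i) :
    ν.localSpacing i ≤ |ν.pos i - ν.pos j| :=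
  ((ν.le_localSpacing_iff i _).1 le_rfl).2 j h

theorem localSpacing_pos (ν : CPEnvironment m) (i : Fin m) : 0 < ν.localSpacing i := by
  unfold localSpacing spacing
  refine lt_min ?_ ?_
  all_goals
    split_ifs with h
    · exact sub_pos.2 (ν.pos_strictMono (Fin.mk_lt_mk.2 (by omega)))
    · exact one_pos

/-- Below the cap, the local spacing is attained by a true neighbour: otherwise a number slightly
above it would still bound all the distances and the cap from below. -/
theorem exists_abs_eq_localSpacing (ν : CPEnvironment m) {i : Fin m} (h : ν.localSpacing i < 1) :
    ∃ j, j ≠ i ∧ |ν.pos i - ν.pos j| = ν.localSpacing i := by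
  by_contra! hne
  have hlt : ∀ j, j ≠ i → ν.localSpacing i < |ν.pos i - ν.pos j| := fun j hj =>
    lt_of_le_of_ne (ν.localSpacing_le_abs hj) (hne j hj).symm
  obtain ⟨b, hb1, hb2⟩ := Finset.exists_between' {ν.localSpacing i}
    (insert 1 ((Finset.univ.filter (· ≠ i)).image fun j => |ν.pos i - ν.pos j|))
    (by
      intro x hx y hy
      rw [Finset.mem_singleton] at hx
      subst hx
      rcases Finset.mem_insert.1 hy with rfl | hy
      · exact h
      · obtain ⟨j, hj, rfl⟩ := Finset.mem_image.1 hy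
        exact hlt j (Finset.mem_filter.1 hj).2)
  have := (ν.le_localSpacing_iff i b).2 ⟨(hb2 1 (by simp)).le, fun j hj => (hb2 _
    (Finset.mem_insert_of_mem (Finset.mem_image_of_mem _ (by simpa using hj)))).le⟩
  exact absurd (hb1 _ (Finset.mem_singleton_self _)) (not_lt.2 this)

theorem jump_sq_pos (ν : CPEnvironment m) (i : Fin m) : 0 < ν.jump i ^ 2 :=
  sq_pos_of_ne_zero (ν.jump_ne_zero i)

theorem energySq_pos (ν : CPEnvironment m) (i : Fin m) : 0 < ν.energySq i :=
  mul_pos (ν.localSpacing_pos i) (ν.jump_sq_pos i)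

theorem one_div_energySq_le (ν : CPEnvironment m) (i : Fin m) :
    1 / ν.energySq i ≤ ν.detectComplexity :=
  le_ciSup (f := fun i => 1 / ν.energySq i) (Set.finite_range _).bddAbove i

theorem detectComplexity_le (ν : CPEnvironment m) (hm : 1 ≤ m) {B : ℝ}
    (h : ∀ i, 1 / ν.energySq i ≤ B) : ν.detectComplexity ≤ B :=
  have : Nonempty (Fin m) := ⟨⟨0, hm⟩⟩
  ciSup_le h

theorem exists_detectComplexity_eq (ν : CPEnvironment m) (hm : 1 ≤ m) :
    ∃ i, ν.detectComplexity = 1 / ν.energySq i := by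
  have : Nonempty (Fin m) := ⟨⟨0, hm⟩⟩
  obtain ⟨i, hi⟩ := exists_eq_ciSup_of_finite (f := fun i => 1 / ν.energySq i)
  exact ⟨i, hi.symm⟩

theorem detectComplexity_pos (ν : CPEnvironment m) (hm : 1 ≤ m) : 0 < ν.detectComplexity := by
  obtain ⟨i, hi⟩ := ν.exists_detectComplexity_eq hm
  rw [hi]
  exact one_div_pos.2 (ν.energySq_pos i)

/-- With the same jumps and all distances multiplied by factors between `c` and `1`, the
detection complexity is multiplied by a factor between `1` and `1 / c`. -/
theorem detectComplexity_bounds (ν ν' : CPEnvironment m) (hm : 1 ≤ m)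
    (hj : ∀ i, ν'.jump i = ν.jump i) {c : ℝ} (hc : 0 < c) (hc1 : c ≤ 1)
    (hlow : ∀ i j, i < j → c * (ν.pos j - ν.pos i) ≤ ν'.pos j - ν'.pos i)
    (hup : ∀ i j, i < j → ν'.pos j - ν'.pos i ≤ ν.pos j - ν.pos i) :
    ν.detectComplexity ≤ ν'.detectComplexity
      ∧ ν'.detectComplexity ≤ c⁻¹ * ν.detectComplexity := by
  have habs : ∀ (μ : CPEnvironment m) i j, i < j → |μ.pos j - μ.pos i| = μ.pos j - μ.pos i :=
    fun μ i j h => abs_of_pos (sub_pos.2 (μ.pos_strictMono h))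
  have hd : ∀ i j, i ≠ j → c * |ν.pos i - ν.pos j| ≤ |ν'.pos i - ν'.pos j|
      ∧ |ν'.pos i - ν'.pos j| ≤ |ν.pos i - ν.pos j| := by
    intro i j hij
    rcases lt_or_gt_of_ne hij with h | h
    · rw [abs_sub_comm, abs_sub_comm (ν'.pos i), habs _ _ _ h, habs _ _ _ h]
      exact ⟨hlow i j h, hup i j h⟩
    · rw [habs _ _ _ h, habs _ _ _ h]
      exact ⟨hlow j i h, hup j i h⟩
  have h1 : ∀ i, ν'.localSpacing i ≤ ν.localSpacing i := fun i =>
    (ν.le_localSpacing_iff i _).2 ⟨ν'.localSpacing_le_one i, fun j hj =>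
      (ν'.localSpacing_le_abs hj).trans (hd i j hj.symm).2⟩
  have h2 : ∀ i, c * ν.localSpacing i ≤ ν'.localSpacing i := fun i =>
    (ν'.le_localSpacing_iff i _).2 ⟨mul_le_one₀ hc1 (ν.localSpacing_pos i).le
      (ν.localSpacing_le_one i), fun j hj =>
      (mul_le_mul_of_nonneg_left (ν.localSpacing_le_abs hj) hc.le).trans (hd i j hj.symm).1⟩
  constructor
  · refine ν.detectComplexity_le hm fun i => le_trans ?_ (ν'.one_div_energySq_le i)
    refine one_div_le_one_div_of_le (ν'.energySq_pos i) ?_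
    unfold energySq
    rw [hj]
    exact mul_le_mul_of_nonneg_right (h1 i) (sq_nonneg _)
  · refine ν'.detectComplexity_le hm fun i => le_trans ?_
      (mul_le_mul_of_nonneg_left (ν.one_div_energySq_le i) (inv_pos.2 hc).le)
    rw [inv_mul_eq_div, div_div, mul_comm]
    refine one_div_le_one_div_of_le (mul_pos hc (ν.energySq_pos i)) ?_
    unfold energySq
    rw [hj, ← mul_assoc]
    exact mul_le_mul_of_nonneg_right (h2 i) (sq_nonneg _)

theorem mean_sub_mean (μ μ' : CPEnvironment m) (hb : μ.baseline = μ'.baseline)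
    (hj : μ.jump = μ'.jump) {i : Fin m} (hp : ∀ j, j ≠ i → μ.pos j = μ'.pos j)
    (x : unitInterval) :
    μ.mean x - μ'.mean x = (if μ.pos i ≤ x then μ.jump i else 0)
      - (if μ'.pos i ≤ x then μ.jump i else 0) := by
  unfold mean
  rw [hb, hj, add_sub_add_left_eq_sub, ← Finset.sum_sub_distrib]
  refine Finset.sum_eq_single_of_mem i (Finset.mem_univ _) fun j _ hji => ?_
  rw [hp j hji, sub_self]

theorem mean_eq_of_notMem (μ μ' : CPEnvironment m) (hb : μ.baseline = μ'.baseline)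
    (hj : μ.jump = μ'.jump) {i : Fin m} (hp : ∀ j, j ≠ i → μ.pos j = μ'.pos j)
    {x : unitInterval} {a b : ℝ} (ha : a ≤ μ.pos i) (ha' : a ≤ μ'.pos i) (hb' : μ.pos i ≤ b)
    (hb'' : μ'.pos i ≤ b) (hx : ¬ (a ≤ x ∧ (x : ℝ) < b)) : μ.mean x = μ'.mean x := by
  rw [← sub_eq_zero, mean_sub_mean μ μ' hb hj hp]
  by_cases h : a ≤ x
  · have : b ≤ x := not_lt.1 fun hc => hx ⟨h, hc⟩
    rw [if_pos (by linarith), if_pos (by linarith), sub_self]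
  · have := not_le.1 h
    rw [if_neg (by linarith), if_neg (by linarith), sub_self]

theorem mean_sub_mean_sq_le (μ μ' : CPEnvironment m) (hb : μ.baseline = μ'.baseline)
    (hj : μ.jump = μ'.jump) {i : Fin m} (hp : ∀ j, j ≠ i → μ.pos j = μ'.pos j)
    (x : unitInterval) : (μ.mean x - μ'.mean x) ^ 2 ≤ μ.jump i ^ 2 := by
  rw [mean_sub_mean μ μ' hb hj hp]
  split_ifs <;> simp [sq_nonneg]

end CPEnvironment

/-! ### Correctness expressed on the trace of observations. -/

namespace CPAlgorithm

variable {N m : ℕ} (π : CPAlgorithm N)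

theorem budget_eq_duration (ν : CPEnvironment m) (ω : π.Outcome) :
    π.budget ν ω = π.duration (π.play ν.mean ω) := by
  unfold budget duration
  simp_rw [trunc_play, history_eq_trajectory]

theorem expectedBudget_eq {ν : CPEnvironment m} (hν : ν.noise = gaussianReal 0 1) :
    π.expectedBudget ν = ∫⁻ ω, (π.duration ω : ℝ≥0∞) ∂π.traceLaw ν.mean := by
  unfold expectedBudget traceLaw
  have h : π.law ν = π.gaussianLaw := by unfold law gaussianLaw; rw [hν]
  simp_rw [h, budget_eq_duration, ← visits_univ]
  rw [lintegral_map (π.measurable_visits MeasurableSet.univ) (π.measurable_play ν.measurable_mean)]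

/-- The traces on which the estimates after `n` observations are within `η` of `p`. -/
def accurate (p : Fin N → ℝ) (η : ℝ) (n : ℕ) : Set π.Outcome :=
  {ω | ∀ l, |π.estimate n (π.trunc n ω) l - p l| ≤ η}

theorem measurable_estimate_past (n : ℕ) (l : Fin N) :
    Measurable[π.past n] fun ω => π.estimate n (π.trunc n ω) l :=
  (measurable_pi_apply l).comp ((π.measurable_estimate n).comp (π.measurable_trunc_past le_rfl))

theorem measurableSet_accurate (p : Fin N → ℝ) (η : ℝ) (n : ℕ) :
    MeasurableSet[π.past n] (π.accurate p η n) := by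
  have : π.accurate p η n
      = ⋂ l, (fun ω => π.estimate n (π.trunc n ω) l) ⁻¹' {e | |e - p l| ≤ η} := by
    ext; simp [accurate]
  rw [this]
  refine MeasurableSet.iInter fun l => π.measurable_estimate_past n l ?_
  exact measurableSet_le (by fun_prop) measurable_const

/-- The algorithm halts and its estimates are within `η` of `p`. -/
def success (p : Fin N → ℝ) (η : ℝ) : Set π.Outcome :=
  {ω | ∃ n : ℕ, π.duration ω = n ∧ ω ∈ π.accurate p η n}

theorem measurableSet_stopped {A : ℕ → Set π.Outcome}
    (hA : ∀ n, MeasurableSet[π.past n] (A n)) :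
    MeasurableSet {ω | ∃ n : ℕ, π.duration ω = n ∧ ω ∈ A n} := by
  have : {ω | ∃ n : ℕ, π.duration ω = n ∧ ω ∈ A n}
      = ⋃ n : ℕ, {ω | π.duration ω = n} ∩ A n := by ext; simp
  rw [this]
  exact MeasurableSet.iUnion fun n =>
    π.past_le n _ ((π.measurableSet_duration_eq n).inter (hA n))

theorem measurableSet_success (p : Fin N → ℝ) (η : ℝ) : MeasurableSet (π.success p η) :=
  π.measurableSet_stopped fun n => π.measurableSet_accurate p η n

/-- With as many estimates as change points, the increasing matching is a strictly monotone self-map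
of `Fin m`, hence the identity: the l-th estimate must approach the l-th change point. -/
theorem IsCorrect.le_traceLaw_success {π : CPAlgorithm m} {δ η : ℝ} (hπ : π.IsCorrect δ η)
    {ν : CPEnvironment m} (hν : ν.noise = gaussianReal 0 1) :
    ENNReal.ofReal (1 - δ) ≤ π.traceLaw ν.mean (π.success ν.pos η) := by
  have h := hπ m le_rfl ν
  have hlaw : π.law ν = π.gaussianLaw := by unfold law gaussianLaw; rw [hν]
  rw [hlaw] at h
  unfold traceLaw
  rw [Measure.map_apply (π.measurable_play ν.measurable_mean) (π.measurableSet_success _ _)]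
  refine h.trans (measure_mono ?_)
  rintro ω ⟨t, ht, i, hi, hest⟩
  have hid : i = id := by
    have : StrictMono.orderIsoOfSurjective i hi
        (Finite.surjective_of_injective hi.injective) = OrderIso.refl _ := Subsingleton.elim _ _
    funext j
    exact congrArg (fun e : Fin m ≃o Fin m => e j) this
  refine ⟨t, by rw [← budget_eq_duration]; exact ht, fun l => ?_⟩
  have := hest l
  rw [hid] at this
  rw [trunc_play, ← history_eq_trajectory]
  exact this

/-- The halting time and the estimates are functions of the trace, so a common trace would put one
estimate within η of two numbers more than 2η apart. -/
theorem disjoint_success {p q : Fin N → ℝ} {η : ℝ} {l : Fin N} (h : 2 * η < |q l - p l|) :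
    Disjoint (π.success p η) (π.success q η) := by
  refine Set.disjoint_left.2 ?_
  rintro ω ⟨n, hn, hA⟩ ⟨n', hn', hA'⟩
  have : n = n' := by exact_mod_cast hn.symm.trans hn'
  subst this
  have h1 := hA l
  have h2 := hA' l
  rw [abs_le] at h1 h2
  rcases abs_cases (q l - p l) with h3 | h3 <;> linarith

theorem mul_traceLaw_visits_le {g : unitInterval → ℝ}
    {J : Set unitInterval} (hJ : MeasurableSet J) {d v : ℝ} (hd : d ≠ 0) :
    ENNReal.ofReal (v / d ^ 2)
      * π.traceLaw g {ω | ENNReal.ofReal v < ENNReal.ofReal (d ^ 2) * π.visits J ω}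
      ≤ ∫⁻ ω, π.visits J ω ∂π.traceLaw g := by
  refine le_trans ?_ (mul_meas_ge_le_lintegral (π.measurable_visits hJ) (ENNReal.ofReal (v / d ^ 2)))
  gcongr with ω
  intro hω
  have hd2 : 0 < d ^ 2 := sq_pos_of_ne_zero hd
  rw [ENNReal.ofReal_div_of_pos hd2]
  exact ENNReal.div_le_of_le_mul' (le_of_lt hω)

end CPAlgorithm

/-! ### The price of moving change points by more than 2η. -/

/-- The points of the unit interval that lie in `[a, b)`. -/
def window (a b : ℝ) : Set unitInterval := {x | a ≤ x ∧ (x : ℝ) < b}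

theorem measurableSet_window (a b : ℝ) : MeasurableSet (window a b) :=
  measurable_subtype_coe measurableSet_Ico

theorem disjoint_window {a b a' b' : ℝ} (h : b ≤ a') : Disjoint (window a b) (window a' b') :=
  Set.disjoint_left.2 fun _ hx hx' => absurd (hx.2.trans_le (h.trans hx'.1)) (lt_irrefl _)

theorem ENNReal.ofReal_half_add_le {x y : ℝ} {E : ℝ≥0∞} (hx : ENNReal.ofReal x ≤ E)
    (hy : ENNReal.ofReal y ≤ E) : ENNReal.ofReal ((x + y) / 2) ≤ E := by
  rcases le_total x y with h | h
  · exact (ENNReal.ofReal_le_ofReal (by linarith)).trans hy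
  · exact (ENNReal.ofReal_le_ofReal (by linarith)).trans hx

theorem strictMono_update {m : ℕ} {p : Fin m → ℝ} (hp : StrictMono p) {i : Fin m} {z : ℝ}
    (h1 : ∀ j, j < i → p j < z) (h2 : ∀ j, i < j → z < p j) :
    StrictMono (Function.update p i z) := by
  intro a b hab
  rcases eq_or_ne a i with rfl | ha
  · rw [Function.update_self, Function.update_of_ne hab.ne']
    exact h2 b hab
  · rw [Function.update_of_ne ha]
    rcases eq_or_ne b i with rfl | hb
    · rw [Function.update_self]; exact h1 a hab
    · rw [Function.update_of_ne hb]; exact hp hab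

namespace CPAlgorithm

variable {N m : ℕ} (π : CPAlgorithm N)

theorem le_add_traceLaw_visits {g : unitInterval → ℝ} {S : Set π.Outcome} {J : Set unitInterval}
    {d v : ℝ} {p q : ℝ≥0∞} (hp : p ≤ π.traceLaw g S)
    (hq : π.traceLaw g {ω | ω ∈ S ∧ ENNReal.ofReal (d ^ 2) * π.visits J ω ≤ ENNReal.ofReal v}
      ≤ q) :
    p ≤ q + π.traceLaw g {ω | ENNReal.ofReal v < ENNReal.ofReal (d ^ 2) * π.visits J ω} := by
  refine hp.trans (le_trans (measure_mono ?_) ((measure_union_le _ _).trans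
    (add_le_add_left hq _)))
  intro ω hω
  by_cases h : ENNReal.ofReal (d ^ 2) * π.visits J ω ≤ ENNReal.ofReal v
  · exact Or.inl ⟨hω, h⟩
  · exact Or.inr (not_le.1 h)

/-- Two environments whose change points cannot be estimated simultaneously force the algorithm
to query where they differ. -/
theorem IsCorrect.le_lintegral_visits {π : CPAlgorithm m} {δ η : ℝ} (hπ : π.IsCorrect δ η)
    (hδ : δ ∈ Set.Ioo (0 : ℝ) (1 / 16)) {μ μ' : CPEnvironment m}
    (hμ : μ.noise = gaussianReal 0 1) (hμ' : μ'.noise = gaussianReal 0 1)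
    {J : Set unitInterval} (hJ : MeasurableSet J) {d : ℝ} (hd0 : d ≠ 0)
    (hgh : ∀ x ∉ J, μ.mean x = μ'.mean x) (hd : ∀ x, (μ.mean x - μ'.mean x) ^ 2 ≤ d ^ 2)
    {l : Fin m} (hl : 2 * η < |μ'.pos l - μ.pos l|) :
    ENNReal.ofReal (7 / 16 * Real.log (1 / (4 * δ)) * (1 / d ^ 2))
      ≤ ∫⁻ ω, π.visits J ω ∂π.traceLaw μ.mean := by
  obtain ⟨hδ0, hδ1⟩ := hδ
  set v := Real.log (1 / (4 * δ)) with hv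
  have hv0 : 0 ≤ v := Real.log_nonneg (by rw [le_div_iff₀ (by positivity)]; linarith)
  have hexp : Real.exp v = 1 / (4 * δ) := Real.exp_log (by positivity)
  have hP' : π.traceLaw μ'.mean (π.success μ.pos η) ≤ ENNReal.ofReal δ := by
    have := π.isProbabilityMeasure_traceLaw μ'.measurable_mean
    have h1 := hπ.le_traceLaw_success hμ'
    have h2 : π.traceLaw μ'.mean (π.success μ.pos η) ≤ π.traceLaw μ'.mean (π.success μ'.pos η)ᶜ :=
      measure_mono (π.disjoint_success hl).subset_compl_right
    rw [prob_compl_eq_one_sub (π.measurableSet_success _ _)] at h2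
    refine h2.trans ((tsub_le_tsub_left h1 1).trans ?_)
    rw [← ENNReal.ofReal_one, ← ENNReal.ofReal_sub _ (by linarith)]
    exact ENNReal.ofReal_le_ofReal (by linarith)
  -- With e^v = 1/(4δ), the choice λ = 1/(2δ) makes both terms of the comparison at most 1/4.
  -- Success with few visits then has probability at most 1/2, which leaves at least 15/16 - 1/2 =
  -- 7/16 for many visits.
  have h1 := π.traceLaw_stopped_le μ.measurable_mean μ'.measurable_mean hJ hgh hd
    (fun n => π.measurableSet_accurate μ.pos η n) hv0 (lam := 1 / (2 * δ)) (by positivity)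
  have h2 : ENNReal.ofReal (1 / (2 * δ) / 2) * π.traceLaw μ'.mean (π.success μ.pos η)
        + ENNReal.ofReal (Real.exp v / (2 * (1 / (2 * δ)))) ≤ ENNReal.ofReal (1 / 2) := by
    refine (add_le_add_left (mul_le_mul_right hP' _) _).trans ?_
    rw [← ENNReal.ofReal_mul (by positivity), ← ENNReal.ofReal_add (by positivity) (by positivity)]
    refine ENNReal.ofReal_le_ofReal ?_
    rw [hexp]
    field_simp
    norm_num
  have h3 := π.le_add_traceLaw_visits (hπ.le_traceLaw_success hμ) (h1.trans h2)
  have h4 : ENNReal.ofReal (7 / 16) ≤ π.traceLaw μ.mean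
      {ω | ENNReal.ofReal v < ENNReal.ofReal (d ^ 2) * π.visits J ω} := by
    have h5 : ENNReal.ofReal (1 / 2) + ENNReal.ofReal (7 / 16) ≤ ENNReal.ofReal (1 - δ) := by
      rw [← ENNReal.ofReal_add (by norm_num) (by norm_num)]
      exact ENNReal.ofReal_le_ofReal (by linarith)
    exact (ENNReal.add_le_add_iff_left ENNReal.ofReal_ne_top).1 (h5.trans h3)
  refine le_trans ?_ (π.mul_traceLaw_visits_le hJ (v := v) hd0)
  refine le_trans (le_of_eq ?_) (mul_le_mul_right h4 _)
  rw [← ENNReal.ofReal_mul (by positivity)]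
  congr 1
  ring

theorem sum_lintegral_visits_le {ν : CPEnvironment m} (hν : ν.noise = gaussianReal 0 1)
    {ι : Type*} (S : Finset ι) {J : ι → Set unitInterval} (hJm : ∀ i, MeasurableSet (J i))
    (hJ : (S : Set ι).PairwiseDisjoint J) :
    ∑ i ∈ S, ∫⁻ ω, π.visits (J i) ω ∂π.traceLaw ν.mean ≤ π.expectedBudget ν := by
  rw [π.expectedBudget_eq hν, ← lintegral_finsetSum _ fun i _ => π.measurable_visits (hJm i)]
  exact lintegral_mono fun ω => π.sum_visits_le S hJ ω

/-- Each change point that can be moved by more than `2η`, all in disjoint regions, costs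
`log (1 / (4δ)) / Δ²`. -/
theorem IsCorrect.expectedBudget_ge_of_moves {π : CPAlgorithm m} {δ η : ℝ}
    (hπ : π.IsCorrect δ η) (hδ : δ ∈ Set.Ioo (0 : ℝ) (1 / 16)) {μ : CPEnvironment m}
    (hμ : μ.noise = gaussianReal 0 1) (S : Finset (Fin m)) (z a b : Fin m → ℝ)
    (hmono : ∀ i ∈ S, StrictMono (Function.update μ.pos i (z i)))
    (hmem : ∀ i ∈ S, z i ∈ Set.Ioo (0 : ℝ) 1) (hfar : ∀ i ∈ S, 2 * η < |z i - μ.pos i|)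
    (ha : ∀ i ∈ S, a i ≤ μ.pos i ∧ a i ≤ z i) (hb : ∀ i ∈ S, μ.pos i ≤ b i ∧ z i ≤ b i)
    (hdisj : ∀ i ∈ S, ∀ j ∈ S, i < j → b i ≤ a j) :
    ENNReal.ofReal (7 / 16 * Real.log (1 / (4 * δ)) * ∑ i ∈ S, 1 / μ.jump i ^ 2)
      ≤ π.expectedBudget μ := by
  have hlog : 0 ≤ Real.log (1 / (4 * δ)) :=
    Real.log_nonneg (by rw [le_div_iff₀ (by linarith [hδ.1])]; linarith [hδ.2])
  refine le_trans ?_ (π.sum_lintegral_visits_le hμ S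
    (J := fun i => window (a i) (b i)) (fun i => measurableSet_window _ _) ?_)
  · rw [Finset.mul_sum, ENNReal.ofReal_sum_of_nonneg fun i _ => by positivity]
    refine Finset.sum_le_sum fun i hi => ?_
    let μ' : CPEnvironment m :=
      { μ with
        pos := Function.update μ.pos i (z i)
        pos_strictMono := hmono i hi
        pos_mem := fun j => by
          rcases eq_or_ne j i with rfl | hj
          · rw [Function.update_self]; exact hmem j hi
          · rw [Function.update_of_ne hj]; exact μ.pos_mem j }
    have hpi : μ'.pos i = z i := Function.update_self _ _ _
    have hpj : ∀ j, j ≠ i → μ.pos j = μ'.pos j := fun j hj => (Function.update_of_ne hj _ _).symm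
    refine hπ.le_lintegral_visits hδ hμ (μ' := μ') hμ (measurableSet_window _ _)
      (μ.jump_ne_zero i) (fun x hx => ?_)
      (CPEnvironment.mean_sub_mean_sq_le μ μ' rfl rfl hpj) (l := i) ?_
    · exact CPEnvironment.mean_eq_of_notMem μ μ' rfl rfl hpj (ha i hi).1
        (by rw [hpi]; exact (ha i hi).2) (hb i hi).1 (by rw [hpi]; exact (hb i hi).2) hx
    · rw [hpi]; exact hfar i hi
  · intro i hi j hj hij
    rcases lt_or_gt_of_ne hij with h | h
    · exact disjoint_window (hdisj i hi j hj h)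
    · exact (disjoint_window (hdisj j hj i hi h)).symm

/-- When all moves go to the right and stop before the next change point, the swept intervals [x_i,
z_i) are automatically disjoint. The target z_i is any point strictly between x_i + 2η and both the
later change points and 1. -/
theorem IsCorrect.expectedBudget_ge_of_right {π : CPAlgorithm m} {δ η : ℝ}
    (hπ : π.IsCorrect δ η) (hδ : δ ∈ Set.Ioo (0 : ℝ) (1 / 16)) (hη : 0 < η)
    {μ : CPEnvironment m} (hμ : μ.noise = gaussianReal 0 1) (S : Finset (Fin m))
    (h1 : ∀ i ∈ S, μ.pos i + 2 * η < 1)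
    (h2 : ∀ i ∈ S, ∀ j, i < j → μ.pos i + 2 * η < μ.pos j) :
    ENNReal.ofReal (7 / 16 * Real.log (1 / (4 * δ)) * ∑ i ∈ S, 1 / μ.jump i ^ 2)
      ≤ π.expectedBudget μ := by
  have hex : ∀ i, ∃ z, i ∈ S → μ.pos i + 2 * η < z ∧ z < 1 ∧ ∀ j, i < j → z < μ.pos j := by
    intro i
    by_cases hi : i ∈ S
    · obtain ⟨z, hz1, hz2⟩ := Finset.exists_between' {μ.pos i + 2 * η}
        (insert 1 ((Finset.univ.filter (i < ·)).image μ.pos)) (by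
          intro x hx y hy
          rw [Finset.mem_singleton] at hx
          subst hx
          rcases Finset.mem_insert.1 hy with rfl | hy
          · exact h1 i hi
          · obtain ⟨j, hj, rfl⟩ := Finset.mem_image.1 hy
            exact h2 i hi j (Finset.mem_filter.1 hj).2)
      refine ⟨z, fun _ => ⟨hz1 _ (by simp), hz2 _ (by simp), fun j hj => hz2 _ ?_⟩⟩
      exact Finset.mem_insert_of_mem (Finset.mem_image_of_mem _ (by simpa using hj))
    · exact ⟨0, fun h => absurd h hi⟩
  choose z hz using hex
  refine hπ.expectedBudget_ge_of_moves hδ hμ S z μ.pos z (fun i hi => ?_) (fun i hi => ?_)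
    (fun i hi => ?_) (fun i hi => ?_) (fun i hi => ?_) (fun i hi j hj hij => ?_)
  · have := hz i hi
    exact strictMono_update μ.pos_strictMono (fun j hj => by
      have := μ.pos_strictMono hj; linarith) this.2.2
  · have := hz i hi
    exact ⟨by linarith [(μ.pos_mem i).1], this.2.1⟩
  · have := hz i hi
    exact lt_of_lt_of_le (by linarith) (le_abs_self _)
  · exact ⟨le_rfl, by linarith [(hz i hi).1]⟩
  · exact ⟨by linarith [(hz i hi).1], le_rfl⟩
  · exact ((hz i hi).2.2 j hij).le

theorem IsCorrect.expectedBudget_ge_of_left {π : CPAlgorithm m} {δ η : ℝ}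
    (hπ : π.IsCorrect δ η) (hδ : δ ∈ Set.Ioo (0 : ℝ) (1 / 16)) (hη : 0 < η)
    {μ : CPEnvironment m} (hμ : μ.noise = gaussianReal 0 1) (S : Finset (Fin m))
    (h1 : ∀ i ∈ S, 0 < μ.pos i - 2 * η)
    (h2 : ∀ i ∈ S, ∀ j, j < i → μ.pos j < μ.pos i - 2 * η) :
    ENNReal.ofReal (7 / 16 * Real.log (1 / (4 * δ)) * ∑ i ∈ S, 1 / μ.jump i ^ 2)
      ≤ π.expectedBudget μ := by
  have hex : ∀ i, ∃ z, i ∈ S → z < μ.pos i - 2 * η ∧ 0 < z ∧ ∀ j, j < i → μ.pos j < z := by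
    intro i
    by_cases hi : i ∈ S
    · obtain ⟨z, hz1, hz2⟩ := Finset.exists_between'
        (insert 0 ((Finset.univ.filter (· < i)).image μ.pos)) {μ.pos i - 2 * η} (by
          intro y hy x hx
          rw [Finset.mem_singleton] at hx
          subst hx
          rcases Finset.mem_insert.1 hy with rfl | hy
          · exact h1 i hi
          · obtain ⟨j, hj, rfl⟩ := Finset.mem_image.1 hy
            exact h2 i hi j (Finset.mem_filter.1 hj).2)
      refine ⟨z, fun _ => ⟨hz2 _ (by simp), hz1 _ (by simp), fun j hj => hz1 _ ?_⟩⟩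
      exact Finset.mem_insert_of_mem (Finset.mem_image_of_mem _ (by simpa using hj))
    · exact ⟨0, fun h => absurd h hi⟩
  choose z hz using hex
  refine hπ.expectedBudget_ge_of_moves hδ hμ S z z μ.pos (fun i hi => ?_) (fun i hi => ?_)
    (fun i hi => ?_) (fun i hi => ?_) (fun i hi => ?_) (fun i hi j hj hij => ?_)
  · have := hz i hi
    exact strictMono_update μ.pos_strictMono this.2.2 (fun j hj => by
      have := μ.pos_strictMono hj; linarith)
  · have := hz i hi
    exact ⟨this.2.1, by linarith [(μ.pos_mem i).2]⟩
  · have := hz i hi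
    exact lt_of_lt_of_le (by linarith) (neg_le_abs _)
  · exact ⟨by linarith [(hz i hi).1], le_rfl⟩
  · exact ⟨le_rfl, by linarith [(hz i hi).1]⟩
  · exact ((hz j hj).2.2 i hij).le

/-- Each change point that has room to move by more than `2η` to one side costs
`log (1 / (4δ)) / Δ²`. -/
theorem IsCorrect.expectedBudget_ge_of_room {π : CPAlgorithm m} {δ η : ℝ}
    (hπ : π.IsCorrect δ η) (hδ : δ ∈ Set.Ioo (0 : ℝ) (1 / 16)) (hη : 0 < η)
    {μ : CPEnvironment m} (hμ : μ.noise = gaussianReal 0 1) (S : Finset (Fin m))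
    (h : ∀ i ∈ S, (μ.pos i + 2 * η < 1 ∧ ∀ j, i < j → μ.pos i + 2 * η < μ.pos j) ∨
      (0 < μ.pos i - 2 * η ∧ ∀ j, j < i → μ.pos j < μ.pos i - 2 * η)) :
    ENNReal.ofReal (7 / 32 * Real.log (1 / (4 * δ)) * ∑ i ∈ S, 1 / μ.jump i ^ 2)
      ≤ π.expectedBudget μ := by
  classical
  -- A right move and a left move may sweep the same gap, so the two directions are treated
  -- separately. The larger of the two bounds is at least their average, whence the lost factor 2.
  set R : Fin m → Prop := fun i =>
    μ.pos i + 2 * η < 1 ∧ ∀ j, i < j → μ.pos i + 2 * η < μ.pos j with hR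
  have hr := hπ.expectedBudget_ge_of_right hδ hη hμ (S.filter R)
    (fun i hi => (Finset.mem_filter.1 hi).2.1) (fun i hi => (Finset.mem_filter.1 hi).2.2)
  have hl := hπ.expectedBudget_ge_of_left hδ hη hμ (S.filter fun i => ¬ R i)
    (fun i hi => ((h i (Finset.mem_filter.1 hi).1).resolve_left (Finset.mem_filter.1 hi).2).1)
    (fun i hi => ((h i (Finset.mem_filter.1 hi).1).resolve_left (Finset.mem_filter.1 hi).2).2)
  refine le_trans (le_of_eq ?_) (ENNReal.ofReal_half_add_le hr hl)
  rw [← Finset.sum_filter_add_sum_filter_not S R]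
  congr 1
  ring

end CPAlgorithm

/-! ### Comparable environments and the confidence cost. -/

namespace CPEnvironment

variable {m : ℕ}

/-- The complexities of `ν'` are those of `ν` up to the allowed factors. -/
structure Comparable (ν ν' : CPEnvironment m) : Prop where
  detect_le : ν.detectComplexity ≤ ν'.detectComplexity
  le_detect : ν'.detectComplexity ≤ 4 * ν.detectComplexity
  le_localize : 1 / 2 * ν.localizeComplexity m ≤ ν'.localizeComplexity m
  localize_le : ν'.localizeComplexity m ≤ ν.localizeComplexity m

theorem localizeComplexity_pos (ν : CPEnvironment m) (hm : 1 ≤ m) :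
    0 < ν.localizeComplexity m := by
  rw [localizeComplexity_self]
  exact Finset.sum_pos (fun i _ => one_div_pos.2 (ν.jump_sq_pos i)) ⟨⟨0, hm⟩, Finset.mem_univ _⟩

theorem Comparable.of_distances {ν ν' : CPEnvironment m} (hm : 1 ≤ m)
    (hj : ∀ i, ν'.jump i = ν.jump i)
    (hlow : ∀ i j, i < j → 1 / 4 * (ν.pos j - ν.pos i) ≤ ν'.pos j - ν'.pos i)
    (hup : ∀ i j, i < j → ν'.pos j - ν'.pos i ≤ ν.pos j - ν.pos i) : ν.Comparable ν' := by
  have h := ν.detectComplexity_bounds ν' hm hj (c := 1 / 4) (by norm_num) (by norm_num) hlow hup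
  have h2 : ν'.localizeComplexity m = ν.localizeComplexity m := by
    simp_rw [localizeComplexity_self, hj]
  refine ⟨h.1, ?_, ?_, h2.le⟩
  · convert h.2 using 2; norm_num
  · rw [h2]; linarith [ν.localizeComplexity_pos hm]

/-- Serves to exchange jumps between change points of equal local spacing: both complexities are
then only reindexed. -/
theorem Comparable.of_swap {ν ν' : CPEnvironment m} (hm : 1 ≤ m) (σ : Equiv.Perm (Fin m))
    (hj : ∀ i, ν'.jump i = ν.jump (σ i)) (hs : ∀ i, ν'.localSpacing i = ν.localSpacing (σ i)) :
    ν.Comparable ν' := by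
  have h1 : ν'.detectComplexity = ν.detectComplexity := by
    unfold detectComplexity energySq
    simp_rw [hj, hs]
    exact σ.iSup_comp (g := fun i => 1 / (ν.localSpacing i * ν.jump i ^ 2))
  have h2 : ν'.localizeComplexity m = ν.localizeComplexity m := by
    simp_rw [localizeComplexity_self, hj]
    exact Equiv.sum_comp σ fun i => 1 / ν.jump i ^ 2
  refine ⟨h1.ge, ?_, ?_, h2.le⟩
  · rw [h1]; linarith [ν.detectComplexity_pos hm]
  · rw [h2]; linarith [ν.localizeComplexity_pos hm]

end CPEnvironment

open CPEnvironment in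
/-- The cost of localization with confidence `1 - δ`. -/
theorem CPAlgorithm.IsCorrect.exists_confidence_cost {m : ℕ} {π : CPAlgorithm m} {δ η : ℝ}
    (hπ : π.IsCorrect δ η) (hδ : δ ∈ Set.Ioo (0 : ℝ) (1 / 16))
    (hη : η ∈ Set.Ioo (0 : ℝ) (1 / 8)) (hm : 1 ≤ m) (ν : CPEnvironment m)
    (hν : ∀ i : ℕ, 2 ≤ i → i ≤ m - 1 → 2 * η < ν.spacing i) :
    ∃ ν' : CPEnvironment m, ν.Comparable ν' ∧
      ENNReal.ofReal (7 / 64 * (ν.localizeComplexity m * Real.log (1 / (4 * δ))))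
        ≤ π.expectedBudget ν' := by
  obtain ⟨hη0, hη1⟩ := hη
  have hlog : 0 ≤ Real.log (1 / (4 * δ)) :=
    Real.log_nonneg (by rw [le_div_iff₀ (by linarith [hδ.1])]; linarith [hδ.2])
  have hmono := ν.pos_strictMono.monotone
  -- The hypothesis controls every gap except the first one, between the indices 0 and 1.
  have hgap : ∀ i j : Fin m, i < j → 1 ≤ (i : ℕ) → ν.pos i + 2 * η < ν.pos j := by
    intro i j hij hi
    have hij' : (i : ℕ) < j := hij
    have h1 := hν (i + 1) (by omega) (by omega)
    rw [spacing, dif_pos ⟨by omega, by omega⟩] at h1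
    simp only [Nat.add_sub_cancel, Fin.eta] at h1
    have : ν.pos ⟨i + 1, by omega⟩ ≤ ν.pos j := hmono (Fin.mk_le_mk.2 (by omega))
    linarith
  have hsum : 0 ≤ ∑ i, 1 / ν.jump i ^ 2 :=
    Finset.sum_nonneg fun i _ => one_div_nonneg.2 (sq_nonneg _)
  have hweaken : ∀ {E : ℝ≥0∞},
      ENNReal.ofReal (7 / 32 * Real.log (1 / (4 * δ)) * ∑ i, 1 / ν.jump i ^ 2) ≤ E →
      ENNReal.ofReal (7 / 64 * (ν.localizeComplexity m * Real.log (1 / (4 * δ)))) ≤ E := by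
    intro E hE
    refine le_trans (ENNReal.ofReal_le_ofReal ?_) hE
    rw [localizeComplexity_self]
    nlinarith [mul_nonneg hlog hsum]
  let i0 : Fin m := ⟨0, hm⟩
  by_cases hall : 2 ≤ m ∧ ∀ i j : Fin m, i < j → ν.pos i + 2 * η < ν.pos j
  · obtain ⟨hm2, hall⟩ := hall
    refine ⟨gaussian ν.pos ν.jump ν.pos_strictMono ν.pos_mem ν.jump_ne_zero ν.abs_jump_le_one,
      Comparable.of_distances hm (fun i => rfl) (fun i j hij => ?_) (fun i j hij => le_rfl),
      hweaken ?_⟩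
    · have := ν.pos_strictMono hij
      change 1 / 4 * (ν.pos j - ν.pos i) ≤ ν.pos j - ν.pos i
      linarith
    · refine hπ.expectedBudget_ge_of_room hδ hη0 rfl Finset.univ fun i _ => ?_
      change (ν.pos i + 2 * η < 1 ∧ ∀ j, i < j → ν.pos i + 2 * η < ν.pos j) ∨
        (0 < ν.pos i - 2 * η ∧ ∀ j, j < i → ν.pos j < ν.pos i - 2 * η)
      -- Every point moves right except the last one, which moves left into the gap before it; `2 ≤
      -- m` provides that gap.
      by_cases hi : (i : ℕ) + 1 < m
      · left
        have hlt : i < (⟨i + 1, hi⟩ : Fin m) := Fin.mk_lt_mk.2 (by omega)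
        exact ⟨(hall _ _ hlt).trans (ν.pos_mem _).2, fun j hj => hall i j hj⟩
      · right
        have hlt : i0 < i := Fin.mk_lt_mk.2 (by omega)
        exact ⟨by linarith [hall _ _ hlt, (ν.pos_mem i0).1],
          fun j hj => by linarith [hall j i hj]⟩
  · have hclose : ∀ i : Fin m, (i : ℕ) ≤ 1 → ν.pos i ≤ ν.pos i0 + 2 * η := by
      intro i hi
      rcases Nat.eq_zero_or_pos (i : ℕ) with h0 | h0
      · have : i = i0 := Fin.ext h0
        rw [this]; linarith
      · by_contra! hc
        refine hall ⟨by omega, fun a b hab => ?_⟩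
        have hab' : (a : ℕ) < b := hab
        by_cases ha : 1 ≤ (a : ℕ)
        · exact hgap a b hab ha
        · have : a = i0 := Fin.ext (by change (a : ℕ) = 0; omega)
          have h2 : ν.pos i ≤ ν.pos b := hmono (Fin.mk_le_mk.2 (by omega))
          rw [this]; linarith
    rcases le_or_gt m 2 with hm2 | hm3
    · have hm2' : ∀ i : Fin m, ν.pos i ≤ ν.pos i0 + 2 * η := fun i => hclose i (by omega)
      have h0le : ∀ i : Fin m, ν.pos i0 ≤ ν.pos i := fun i => hmono (Fin.mk_le_mk.2 (by omega))
      -- The short configuration, of length at most 2η, is translated to start at 1/2. As η < 1/8,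
      -- there is room for 2η more on either side: 1/2 - 2η > 0 and 1/2 + 4η < 1.
      refine ⟨gaussian (fun i => 1 / 2 + (ν.pos i - ν.pos i0)) ν.jump
        (fun i j hij => by have := ν.pos_strictMono hij; dsimp only; linarith)
        (fun i => ⟨by linarith [h0le i], by linarith [hm2' i]⟩) ν.jump_ne_zero ν.abs_jump_le_one,
        Comparable.of_distances hm (fun i => rfl) (fun i j hij => ?_) (fun i j hij => ?_),
        hweaken ?_⟩
      · have := ν.pos_strictMono hij
        simp only [gaussian]
        linarith
      · simp only [gaussian]
        linarith
      · refine hπ.expectedBudget_ge_of_room hδ hη0 rfl Finset.univ fun i _ => ?_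
        simp only [gaussian]
        rcases Nat.eq_zero_or_pos (i : ℕ) with h0 | h0
        · right
          refine ⟨by linarith [h0le i], fun j hj => ?_⟩
          have hj' : (j : ℕ) < i := hj
          omega
        · left
          refine ⟨by linarith [hm2' i], fun j hj => ?_⟩
          have hj' : (i : ℕ) < j := hj
          omega
    · let i1 : Fin m := ⟨1, by omega⟩
      have h01 : i0 ≠ i1 := by simp [i0, i1]
      have hroom : ∀ i ∈ Finset.univ.erase i0,
          (ν.pos i + 2 * η < 1 ∧ ∀ j, i < j → ν.pos i + 2 * η < ν.pos j) ∨
          (0 < ν.pos i - 2 * η ∧ ∀ j, j < i → ν.pos j < ν.pos i - 2 * η) := by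
        intro i hi
        have hi0 : 1 ≤ (i : ℕ) := by
          by_contra hc
          exact (Finset.mem_erase.1 hi).1 (Fin.ext (by change (i : ℕ) = 0; omega))
        by_cases hl : (i : ℕ) + 1 < m
        · left
          have hlt : i < (⟨i + 1, hl⟩ : Fin m) := Fin.mk_lt_mk.2 (by omega)
          exact ⟨(hgap _ _ hlt hi0).trans (ν.pos_mem _).2, fun j hj => hgap i j hj hi0⟩
        · right
          have hlt : i1 < i := Fin.mk_lt_mk.2 (by omega)
          have h1 := hgap _ _ hlt le_rfl
          refine ⟨by linarith [(ν.pos_mem i1).1], fun j hj => ?_⟩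
          by_cases hj0 : 1 ≤ (j : ℕ)
          · linarith [hgap j i hj hj0]
          · have : ν.pos j ≤ ν.pos i1 := hmono (Fin.mk_le_mk.2 (by omega))
            linarith
      -- The first point may have no room, so it is dropped from the sum. Exchanging the first two
      -- jumps decides which of them is lost. This leaves both complexities unchanged, since the
      -- first gap is at most 2η, hence below the second, and is the local spacing of both points.
      let σ : Equiv.Perm (Fin m) := Equiv.swap i0 i1
      set μ := gaussian ν.pos ν.jump ν.pos_strictMono ν.pos_mem ν.jump_ne_zero
        ν.abs_jump_le_one with hμ
      set μ' := gaussian ν.pos (fun i => ν.jump (σ i)) ν.pos_strictMono ν.pos_mem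
        (fun i => ν.jump_ne_zero _) (fun i => ν.abs_jump_le_one _) with hμ'
      have hc : ν.Comparable μ := Comparable.of_swap hm 1 (fun i => rfl) fun i => rfl
      have hc' : ν.Comparable μ' := by
        refine Comparable.of_swap hm σ (fun i => rfl) fun i => ?_
        change ν.localSpacing i = ν.localSpacing (σ i)
        have hs1 : ν.spacing 1 = ν.pos i1 - ν.pos i0 := by
          rw [spacing, dif_pos ⟨le_rfl, by omega⟩]
        have hs2 : 2 * η < ν.spacing 2 := hν 2 le_rfl (by omega)
        have hs0 : ν.spacing 0 = 1 := by rw [spacing, dif_neg (by omega)]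
        have h1 : ν.localSpacing i0 = ν.spacing 1 := by
          unfold localSpacing
          change min (ν.spacing 0) (ν.spacing 1) = _
          rw [hs0]; exact min_eq_right (ν.spacing_le_one _)
        have h2 : ν.localSpacing i1 = ν.spacing 1 := by
          unfold localSpacing
          change min (ν.spacing 1) (ν.spacing 2) = _
          refine min_eq_left ?_
          rw [hs1]
          linarith [hclose i1 le_rfl]
        by_cases hi0 : i = i0
        · rw [hi0, Equiv.swap_apply_left, h1, h2]
        · by_cases hi1 : i = i1
          · rw [hi1, Equiv.swap_apply_right, h1, h2]
          · rw [Equiv.swap_apply_of_ne_of_ne hi0 hi1]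
      have hE := hπ.expectedBudget_ge_of_room hδ hη0 (μ := μ) rfl _ hroom
      have hE' := hπ.expectedBudget_ge_of_room hδ hη0 (μ := μ') rfl _ hroom
      have hf : ∀ i, 0 ≤ 1 / ν.jump i ^ 2 := fun i => one_div_nonneg.2 (sq_nonneg _)
      have hA : ∑ i, 1 / ν.jump i ^ 2
          = ∑ i ∈ Finset.univ.erase i0, 1 / ν.jump i ^ 2 + 1 / ν.jump i0 ^ 2 :=
        (Finset.sum_erase_add _ _ (Finset.mem_univ i0)).symm
      have hB : 1 / ν.jump i0 ^ 2
          ≤ ∑ i ∈ Finset.univ.erase i0, 1 / ν.jump (σ i) ^ 2 := by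
        have := Finset.single_le_sum (f := fun i => 1 / ν.jump (σ i) ^ 2) (fun i _ => hf (σ i))
          (Finset.mem_erase.2 ⟨h01.symm, Finset.mem_univ i1⟩)
        simpa [σ] using this
      -- The jump dropped in one arrangement is counted at `i1` in the other, so the two partial
      -- sums together dominate the full sum, and the larger one keeps at least half of it.
      rcases le_total (∑ i ∈ Finset.univ.erase i0, 1 / ν.jump i ^ 2)
        (∑ i ∈ Finset.univ.erase i0, 1 / ν.jump (σ i) ^ 2) with hle | hle
      · refine ⟨μ', hc', le_trans (ENNReal.ofReal_le_ofReal ?_) hE'⟩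
        rw [localizeComplexity_self, hA]
        change _ ≤ 7 / 32 * Real.log (1 / (4 * δ))
          * ∑ i ∈ Finset.univ.erase i0, 1 / ν.jump (σ i) ^ 2
        nlinarith
      · refine ⟨μ, hc, le_trans (ENNReal.ofReal_le_ofReal ?_) hE⟩
        rw [localizeComplexity_self, hA]
        change _ ≤ 7 / 32 * Real.log (1 / (4 * δ))
          * ∑ i ∈ Finset.univ.erase i0, 1 / ν.jump i ^ 2
        nlinarith

/-! ### The cost of searching at resolution η. -/

/-- The involution of `(∀ i, β i) × β i` exchanging the `i`-th coordinate with the extra one. -/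
def exchangeCoordinate {ι : Type*} [DecidableEq ι] (β : ι → Type*) (i : ι) :
    Equiv.Perm ((∀ j, β j) × β i) where
  toFun p := (Function.update p.1 i p.2, p.1 i)
  invFun p := (Function.update p.1 i p.2, p.1 i)
  left_inv p := by simp
  right_inv p := by simp

/-- If in every coordinate direction the average of `F i` is at least `b i`, then some point has
`∑ b i ≤ ∑ F i`. -/
theorem exists_sum_le_of_coordinate_averages {ι : Type*} [Fintype ι] [DecidableEq ι]
    {β : ι → Type*} [∀ i, Fintype (β i)] [∀ i, Nonempty (β i)] (F : ι → (∀ i, β i) → ℝ≥0∞)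
    (b : ι → ℝ≥0∞)
    (h : ∀ i κ, (Fintype.card (β i) : ℝ≥0∞) * b i ≤ ∑ k, F i (Function.update κ i k)) :
    ∃ κ, ∑ i, b i ≤ ∑ i, F i κ := by
  -- Double counting: exchanging the fresh value k with the i-th coordinate turns the updated point
  -- into the base point, with a free extra value.
  have hswap : ∀ i, ∑ κ, ∑ k, F i (Function.update κ i k)
      = (Fintype.card (β i) : ℝ≥0∞) * ∑ κ, F i κ := by
    intro i
    rw [← Fintype.sum_prod_type' (f := fun κ k => F i (Function.update κ i k))]
    refine (Equiv.sum_comp (exchangeCoordinate β i) (fun p => F i p.1)).trans ?_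
    rw [Fintype.sum_prod_type]
    simp [Finset.mul_sum]
  have hi : ∀ i, ∑ _κ : (∀ i, β i), b i ≤ ∑ κ, F i κ := by
    intro i
    have h1 : (Fintype.card (β i) : ℝ≥0∞) * ∑ _κ : (∀ i, β i), b i
        ≤ (Fintype.card (β i) : ℝ≥0∞) * ∑ κ, F i κ := by
      rw [← hswap, Finset.mul_sum]
      exact Finset.sum_le_sum fun κ _ => h i κ
    exact (ENNReal.mul_le_mul_iff_right (by simp [Fintype.card_ne_zero])
      (ENNReal.natCast_ne_top _)).1 h1
  by_contra! hlt
  have h2 := ENNReal.sum_lt_sum_of_nonempty Finset.univ_nonempty fun κ _ => hlt κ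
  rw [Finset.sum_comm, Finset.sum_comm (f := fun κ i => b i)] at h2
  exact absurd h2 (not_lt.2 (Finset.sum_le_sum fun i _ => hi i))

namespace CPAlgorithm

variable {m : ℕ}

/-- Identifying one among many environments that only differ on `J` requires many queries in
`J` on average. -/
theorem IsCorrect.sum_lintegral_visits_ge {π : CPAlgorithm m} {δ η : ℝ} (hπ : π.IsCorrect δ η)
    (hδ : δ ∈ Set.Ioo (0 : ℝ) (1 / 16)) {ι : Type*} [Fintype ι] {μ : ι → CPEnvironment m}
    (hμ : ∀ k, (μ k).noise = gaussianReal 0 1) {h : unitInterval → ℝ} (hh : Measurable h)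
    {J : Set unitInterval} (hJ : MeasurableSet J) {d : ℝ} (hd0 : d ≠ 0)
    (hgh : ∀ k, ∀ x ∉ J, (μ k).mean x = h x) (hd : ∀ k x, ((μ k).mean x - h x) ^ 2 ≤ d ^ 2)
    (hfar : ∀ k k', k ≠ k' → ∃ l, 2 * η < |(μ k').pos l - (μ k).pos l|) :
    ENNReal.ofReal (Fintype.card ι * (7 / 16 * (1 / d ^ 2 * Real.posLog (Fintype.card ι / 4))))
      ≤ ∑ k, ∫⁻ ω, π.visits J ω ∂π.traceLaw (μ k).mean := by
  obtain ⟨hδ0, hδ1⟩ := hδ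
  set K : ℝ := ((Fintype.card ι : ℕ) : ℝ) with hK
  rcases le_or_gt K 4 with hK4 | hK4
  -- With at most four candidates the positive part of the logarithm vanishes and nothing is
  -- claimed.
  · have : Real.posLog (K / 4) = 0 := by
      rw [Real.posLog_eq_zero_iff, abs_le]
      have : 0 ≤ K := Nat.cast_nonneg _
      constructor <;> linarith
    simp [this]
  set v := Real.log (K / 4) with hv
  have hv0 : 0 ≤ v := Real.log_nonneg (by linarith)
  have hpos : Real.posLog (K / 4) = v := max_eq_right hv0
  have hexp : Real.exp v = K / 4 := Real.exp_log (by linarith)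
  -- Under the single reference law the success events of the candidates are disjoint; this plays
  -- the role of Fano's inequality.
  have hsucc : ∑ k, π.traceLaw h (π.success (μ k).pos η) ≤ 1 := by
    have := π.isProbabilityMeasure_traceLaw hh
    rw [← measure_biUnion_finset (s := Finset.univ)]
    · exact prob_le_one
    · intro k _ k' _ hkk
      obtain ⟨l, hl⟩ := hfar k k' hkk
      exact π.disjoint_success hl
    · exact fun k _ => π.measurableSet_success _ _
  have hone : ∀ k, ENNReal.ofReal (15 / 16) ≤ ENNReal.ofReal (K / 4)
      * π.traceLaw h (π.success (μ k).pos η) + ENNReal.ofReal (1 / 4)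
      + π.traceLaw (μ k).mean
        {ω | ENNReal.ofReal v < ENNReal.ofReal (d ^ 2) * π.visits J ω} := by
    intro k
    -- With e^v = K/4 and λ = K/2, the error term is 1/4 for each candidate, and the reference terms
    -- sum to at most K/4. Of the total 15K/16, at least 7K/16 is left for many visits.
    have h1 := π.traceLaw_stopped_le (μ k).measurable_mean hh hJ (hgh k) (hd k)
      (fun n => π.measurableSet_accurate (μ k).pos η n) hv0 (lam := K / 2) (by linarith)
    have h2 := π.le_add_traceLaw_visits (p := ENNReal.ofReal (15 / 16))
      ((ENNReal.ofReal_le_ofReal (by linarith)).trans (hπ.le_traceLaw_success (hμ k))) h1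
    have e1 : K / 2 / 2 = K / 4 := by ring
    have e2 : Real.exp v / (2 * (K / 2)) = 1 / 4 := by rw [hexp]; field_simp
    rw [e1, e2] at h2
    exact h2
  have hsum : ENNReal.ofReal (K * (7 / 16)) ≤ ∑ k, π.traceLaw (μ k).mean
        {ω | ENNReal.ofReal v < ENNReal.ofReal (d ^ 2) * π.visits J ω} := by
    have h1 := Finset.sum_le_sum fun k (_ : k ∈ Finset.univ) => hone k
    rw [Finset.sum_add_distrib, Finset.sum_add_distrib, ← Finset.mul_sum, Finset.sum_const,
      Finset.sum_const, nsmul_eq_mul, nsmul_eq_mul, Finset.card_univ,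
      ← ENNReal.ofReal_natCast, ← hK, ← ENNReal.ofReal_mul (by linarith),
      ← ENNReal.ofReal_mul (by linarith)] at h1
    have h2 : ENNReal.ofReal (K / 4) * ∑ k, π.traceLaw h (π.success (μ k).pos η)
        + ENNReal.ofReal (K * (1 / 4)) ≤ ENNReal.ofReal (K / 2) := by
      refine (add_le_add_left (mul_le_of_le_one_right' hsucc) _).trans ?_
      rw [← ENNReal.ofReal_add (by linarith) (by linarith)]
      exact ENNReal.ofReal_le_ofReal (by linarith)
    have h3 : ENNReal.ofReal (K / 2) + ENNReal.ofReal (K * (7 / 16))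
        ≤ ENNReal.ofReal (K * (15 / 16)) := by
      rw [← ENNReal.ofReal_add (by linarith) (by linarith)]
      exact ENNReal.ofReal_le_ofReal (by linarith)
    exact (ENNReal.add_le_add_iff_left ENNReal.ofReal_ne_top).1
      (h3.trans (h1.trans (add_le_add_left h2 _)))
  refine le_trans ?_ (Finset.sum_le_sum fun k _ => π.mul_traceLaw_visits_le hJ (v := v) hd0)
  rw [← Finset.mul_sum]
  refine le_trans (le_of_eq ?_) (mul_le_mul_right hsum _)
  rw [← ENNReal.ofReal_mul (by positivity), hpos]
  congr 1
  ring

end CPAlgorithm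

open CPEnvironment in
/-- The cost of searching for all the change points at resolution `η`. -/
theorem CPAlgorithm.IsCorrect.exists_search_cost {m : ℕ} {π : CPAlgorithm m} {δ η : ℝ}
    (hπ : π.IsCorrect δ η) (hδ : δ ∈ Set.Ioo (0 : ℝ) (1 / 16))
    (hη : 0 < η) (hm : 1 ≤ m) (ν : CPEnvironment m) :
    ∃ ν' : CPEnvironment m, ν.Comparable ν' ∧
      ENNReal.ofReal (7 / 16 *
        (∑ i, 1 / ν.jump i ^ 2 * Real.posLog (ν.localSpacing i / (16 * η))
          - ν.localizeComplexity m * Real.log (1 / (4 * δ)))) ≤ π.expectedBudget ν' := by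
  set s := ν.localSpacing with hs
  have hs0 : ∀ i, 0 < s i := ν.localSpacing_pos
  have hs1 : ∀ i, s i ≤ 1 := ν.localSpacing_le_one
  have hsd : ∀ i j, i < j → s i ≤ ν.pos j - ν.pos i ∧ s j ≤ ν.pos j - ν.pos i := by
    intro i j hij
    have h1 := ν.localSpacing_le_abs hij.ne'
    have h2 := ν.localSpacing_le_abs hij.ne
    rw [abs_of_pos (sub_pos.2 (ν.pos_strictMono hij))] at h2
    rw [abs_sub_comm, abs_of_pos (sub_pos.2 (ν.pos_strictMono hij))] at h1
    exact ⟨h1, h2⟩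
  set K : Fin m → ℕ := fun i => ⌈s i / (16 * η)⌉₊ with hKdef
  have hK0 : ∀ i, 0 < K i := fun i => Nat.ceil_pos.2 (div_pos (hs0 i) (by linarith))
  have hKle : ∀ i, s i / (16 * η) ≤ K i := fun i => Nat.le_ceil _
  have hKlt : ∀ i, (K i : ℝ) < s i / (16 * η) + 1 := fun i =>
    Nat.ceil_lt_add_one (div_pos (hs0 i) (by linarith)).le
  have : ∀ i, Nonempty (Fin (K i)) := fun i => ⟨⟨0, hK0 i⟩⟩
  -- A grid of `K i` points in a window of width s_i/4 around the nominal position.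
  set o : ∀ i, Fin (K i) → ℝ := fun i k => k * (s i / (4 * K i)) - s i / 8 with ho
  have ho1 : ∀ i k, -(s i / 8) ≤ o i k := by
    intro i k
    have : 0 ≤ (k : ℝ) * (s i / (4 * K i)) :=
      mul_nonneg (Nat.cast_nonneg _) (div_pos (hs0 i) (by have := hK0 i; positivity)).le
    simp only [ho]; linarith
  have ho2 : ∀ i k, o i k ≤ s i / 8 := by
    intro i k
    have hKpos : (0 : ℝ) < K i := by exact_mod_cast hK0 i
    have h1 : ((k : ℕ) : ℝ) ≤ K i := by exact_mod_cast k.2.le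
    have : (k : ℝ) * (s i / (4 * K i)) ≤ K i * (s i / (4 * K i)) :=
      mul_le_mul_of_nonneg_right h1 (div_pos (hs0 i) (by positivity)).le
    have h2 : (K i : ℝ) * (s i / (4 * K i)) = s i / 4 := by field_simp
    simp only [ho]; linarith
  have hofar : ∀ i (k k' : Fin (K i)), k ≠ k' → 2 * η < |o i k' - o i k| := by
    intro i k k' hkk
    have hKpos : (0 : ℝ) < K i := by exact_mod_cast hK0 i
    have hK2 : 2 ≤ K i := by
      have h1 := k.2
      have h2 := k'.2
      have h3 : (k : ℕ) ≠ k' := fun h => hkk (Fin.ext h)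
      omega
    -- Two distinct grid points force `K i ≥ 2`, so the ceiling is less than twice s_i/(16η). That
    -- is exactly what makes the grid step s_i/(4K_i) exceed 2η.
    have hone : 1 < s i / (16 * η) := by
      have h1 : (1 : ℝ) < K i := by exact_mod_cast hK2
      by_contra! hc
      have : K i ≤ 1 :=
        Nat.ceil_le.2 (show s i / (16 * η) ≤ ((1 : ℕ) : ℝ) by exact_mod_cast hc)
      omega
    have hlt : (K i : ℝ) < 2 * (s i / (16 * η)) := by linarith [hKlt i]
    have hstep : 2 * η < s i / (4 * K i) := by
      rw [lt_div_iff₀ (by positivity)]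
      have h1 : 2 * (s i / (16 * η)) = s i / (8 * η) := by field_simp; ring
      rw [h1, lt_div_iff₀ (by positivity)] at hlt
      linarith
    have hdist : (1 : ℝ) ≤ |((k' : ℕ) : ℝ) - ((k : ℕ) : ℝ)| := by
      have h3 : ((k' : ℕ) : ℤ) - ((k : ℕ) : ℤ) ≠ 0 := by
        intro h
        exact hkk (Fin.ext (by omega))
      have := Int.one_le_abs h3
      exact_mod_cast this
    have heq : o i k' - o i k = (((k' : ℕ) : ℝ) - ((k : ℕ) : ℝ)) * (s i / (4 * K i)) := by
      simp only [ho]; ring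
    have hpos : 0 < s i / (4 * K i) := by linarith
    rw [heq, abs_mul, abs_of_pos hpos]
    nlinarith
  -- Halving all distances makes room: each offset is at most s_i/8, so the two offsets of a pair
  -- change its distance by at most a quarter of the original. The result lies between 1/4 and 3/4
  -- of it, and every point stays inside (0, 1).
  set p : (∀ i, Fin (K i)) → Fin m → ℝ := fun κ i => 1 / 4 + ν.pos i / 2 + o i (κ i) with hp
  have hpd : ∀ κ i j, i < j → 1 / 4 * (ν.pos j - ν.pos i) ≤ p κ j - p κ i
      ∧ p κ j - p κ i ≤ ν.pos j - ν.pos i := by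
    intro κ i j hij
    have h1 := hsd i j hij
    have h2 := ho1 i (κ i)
    have h3 := ho2 i (κ i)
    have h4 := ho1 j (κ j)
    have h5 := ho2 j (κ j)
    have h6 := hs0 i
    simp only [hp]
    constructor <;> linarith
  obtain ⟨μ, hμn, hμb, hμp, hμj⟩ : ∃ μ : (∀ i, Fin (K i)) → CPEnvironment m,
      (∀ κ, (μ κ).noise = gaussianReal 0 1) ∧ (∀ κ, (μ κ).baseline = 0) ∧
      (∀ κ, (μ κ).pos = p κ) ∧ ∀ κ, (μ κ).jump = ν.jump :=
    ⟨fun κ => gaussian (p κ) ν.jump (fun i j hij => by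
        have := (hpd κ i j hij).1
        have := ν.pos_strictMono hij
        linarith)
      (fun i => by
        have h2 := ho1 i (κ i)
        have h3 := ho2 i (κ i)
        have h4 := ν.pos_mem i
        have h5 := hs1 i
        simp only [hp]
        exact ⟨by linarith [h4.1], by linarith [h4.2]⟩) ν.jump_ne_zero ν.abs_jump_le_one,
      fun κ => rfl, fun κ => rfl, fun κ => rfl, fun κ => rfl⟩
  set a : Fin m → ℝ := fun i => 1 / 4 + ν.pos i / 2 - s i / 8 with ha
  set b : Fin m → ℝ := fun i => 1 / 4 + ν.pos i / 2 + s i / 8 with hb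
  have hpa : ∀ κ i, a i ≤ p κ i := fun κ i => by
    have := ho1 i (κ i); simp only [ha, hp]; linarith
  have hpb : ∀ κ i, p κ i ≤ b i := fun κ i => by
    have := ho2 i (κ i); simp only [hb, hp]; linarith
  -- With the other coordinates fixed, moving the i-th point over its grid changes the function in
  -- the i-th window only, so the many-candidates bound applies along each coordinate.
  obtain ⟨κ, hκ⟩ := exists_sum_le_of_coordinate_averages
    (fun i κ => ∫⁻ ω, π.visits (window (a i) (b i)) ω ∂π.traceLaw (μ κ).mean)
    (fun i => ENNReal.ofReal (7 / 16 * (1 / ν.jump i ^ 2 * Real.posLog (K i / 4))))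
    (by
      intro i κ
      have hpj : ∀ k, ∀ j, j ≠ i → (μ (Function.update κ i k)).pos j = (μ κ).pos j := by
        intro k j hj
        rw [hμp, hμp]
        simp only [hp]
        rw [Function.update_of_ne hj]
      have hbase : ∀ κ', (μ κ').baseline = (μ κ).baseline := fun κ' => by rw [hμb, hμb]
      have hjump : ∀ κ', (μ κ').jump = (μ κ).jump := fun κ' => by rw [hμj, hμj]
      have := hπ.sum_lintegral_visits_ge hδ (μ := fun k => μ (Function.update κ i k))
        (fun k => hμn _) (h := (μ κ).mean) (μ κ).measurable_mean
        (measurableSet_window (a i) (b i)) (ν.jump_ne_zero i)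
        (fun k x hx => mean_eq_of_notMem (μ _) (μ κ) (hbase _) (hjump _) (hpj k)
          (by rw [hμp]; exact hpa _ i) (by rw [hμp]; exact hpa _ i)
          (by rw [hμp]; exact hpb _ i) (by rw [hμp]; exact hpb _ i) hx)
        (fun k x => by
          have := mean_sub_mean_sq_le (μ _) (μ κ) (hbase _) (hjump _) (hpj k) x
          rwa [hμj] at this)
        (fun k k' hkk => ⟨i, by
          rw [hμp, hμp]
          simp only [hp, Function.update_self]
          rw [add_sub_add_left_eq_sub]
          exact hofar i k k' hkk⟩)
      rw [ENNReal.ofReal_mul (Nat.cast_nonneg _), ENNReal.ofReal_natCast,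
        Fintype.card_fin] at this
      rw [Fintype.card_fin]
      exact this)
  refine ⟨μ κ, Comparable.of_distances hm (fun i => by rw [hμj])
    (fun i j hij => by rw [hμp]; exact (hpd κ i j hij).1)
    (fun i j hij => by rw [hμp]; exact (hpd κ i j hij).2), ?_⟩
  have hfin := hκ.trans (π.sum_lintegral_visits_le (hμn κ) Finset.univ
    (J := fun i => window (a i) (b i)) (fun i => measurableSet_window _ _) (by
      have hab : ∀ i j, i < j → b i ≤ a j := by
        intro i j hij
        have h1 := hsd i j hij
        have h6 := hs0 i
        simp only [ha, hb]
        linarith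
      intro i _ j _ hij
      rcases lt_or_gt_of_ne hij with h | h
      · exact disjoint_window (hab i j h)
      · exact (disjoint_window (hab j i h)).symm))
  refine le_trans ?_ hfin
  rw [← ENNReal.ofReal_sum_of_nonneg fun i _ => mul_nonneg (by norm_num)
    (mul_nonneg (one_div_nonneg.2 (sq_nonneg _)) Real.posLog_nonneg), ← Finset.mul_sum]
  refine ENNReal.ofReal_le_ofReal (mul_le_mul_of_nonneg_left ?_ (by norm_num))
  rw [localizeComplexity_self, Finset.sum_mul, ← Finset.sum_sub_distrib]
  refine Finset.sum_le_sum fun i _ => ?_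
  rw [← mul_sub]
  refine mul_le_mul_of_nonneg_left ?_ (one_div_nonneg.2 (sq_nonneg _))
  -- The factor 1/4 inside the logarithm costs log 4 per change point. Since δ < 1/16, this is at
  -- most log(1/(4δ)), hence the subtracted confidence term.
  have hlog4 : Real.log 4 ≤ Real.log (1 / (4 * δ)) := by
    refine Real.log_le_log (by norm_num) ?_
    rw [le_div_iff₀ (by linarith [hδ.1])]
    linarith [hδ.2]
  have h4 : Real.posLog 4 = Real.log 4 := max_eq_right (Real.log_nonneg (by norm_num))
  have h5 : Real.posLog (s i / (16 * η)) ≤ Real.posLog (K i / 4 * 4) := by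
    refine Real.posLog_le_posLog (div_pos (hs0 i) (by linarith)).le ?_
    have := hKle i
    linarith
  have h6 : Real.posLog ((K i : ℝ) / 4 * 4) ≤ Real.posLog ((K i : ℝ) / 4) + Real.posLog 4 :=
    Real.posLog_mul
  linarith

/-! ### The cost of detecting a bump. -/

namespace CPAlgorithm

variable {m : ℕ}

/-- Markov's inequality for an integer-valued duration; keeping τ + 1 instead of τ is what leaves a
useful bound when τ is a floor that may vanish. -/
theorem natCast_lt_duration_mul_le (π : CPAlgorithm m) {ν : CPEnvironment m}
    (hν : ν.noise = gaussianReal 0 1) (τ : ℕ) :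
    ((τ + 1 : ℕ) : ℝ≥0∞) * π.traceLaw ν.mean {ω | (τ : ℕ∞) < π.duration ω}
      ≤ π.expectedBudget ν := by
  rw [π.expectedBudget_eq hν]
  have hm : Measurable fun ω => (π.duration ω : ℝ≥0∞) := by
    simp_rw [← visits_univ]; exact π.measurable_visits MeasurableSet.univ
  refine le_trans ?_ (mul_meas_ge_le_lintegral hm ((τ + 1 : ℕ) : ℝ≥0∞))
  gcongr with ω
  intro hω
  have h1 : ((τ + 1 : ℕ) : ℕ∞) ≤ π.duration ω := by
    have := Order.add_one_le_of_lt hω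
    exact_mod_cast this
  have h2 : (((τ + 1 : ℕ) : ℕ∞) : ℝ≥0∞) ≤ (π.duration ω : ℝ≥0∞) := by exact_mod_cast h1
  simpa using h2

/-- Markov's inequality summed over k: disjoint regions share τ queries, so on average only few of
them are explored well. -/
theorem sum_traceLaw_count_gt_le (π : CPAlgorithm m) {h : unitInterval → ℝ} (hh : Measurable h)
    {ι : Type*} (S : Finset ι) {J : ι → Set unitInterval} (hJm : ∀ k, MeasurableSet (J k))
    (hJ : (S : Set ι).PairwiseDisjoint J) (d : ℝ) (τ : ℕ) {v : ℝ} (hv : 0 < v) :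
    ∑ k ∈ S, π.traceLaw h {ω | v < d ^ 2 * (π.count (J k) τ ω : ℝ)}
      ≤ ENNReal.ofReal (d ^ 2 * τ / v) := by
  have := π.isProbabilityMeasure_traceLaw hh
  have hmc : ∀ k, Measurable fun ω => d ^ 2 * (π.count (J k) τ ω : ℝ) := by
    intro k
    have : Measurable (π.count (J k) τ) :=
      (π.measurable_count_past (hJm k) le_rfl).mono (π.past_le τ) le_rfl
    fun_prop
  have hms : ∀ k, MeasurableSet {ω | v < d ^ 2 * (π.count (J k) τ ω : ℝ)} := fun k =>
    hmc k measurableSet_Ioi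
  calc ∑ k ∈ S, π.traceLaw h {ω | v < d ^ 2 * (π.count (J k) τ ω : ℝ)}
      = ∑ k ∈ S, ∫⁻ ω, {ω | v < d ^ 2 * (π.count (J k) τ ω : ℝ)}.indicator 1 ω
          ∂π.traceLaw h := by
        refine Finset.sum_congr rfl fun k _ => (lintegral_indicator_one (hms k)).symm
    _ = ∫⁻ ω, ∑ k ∈ S, {ω | v < d ^ 2 * (π.count (J k) τ ω : ℝ)}.indicator 1 ω
          ∂π.traceLaw h :=
        (lintegral_finsetSum _ fun k _ => measurable_one.indicator (hms k)).symm
    _ ≤ ∫⁻ _, ENNReal.ofReal (d ^ 2 * τ / v) ∂π.traceLaw h := by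
        refine lintegral_mono fun ω => ?_
        calc ∑ k ∈ S, {ω | v < d ^ 2 * (π.count (J k) τ ω : ℝ)}.indicator 1 ω
            ≤ ∑ k ∈ S, ENNReal.ofReal (d ^ 2 * (π.count (J k) τ ω : ℝ) / v) := by
              refine Finset.sum_le_sum fun k _ => ?_
              by_cases hk : v < d ^ 2 * (π.count (J k) τ ω : ℝ)
              · rw [Set.indicator_of_mem (by exact hk), Pi.one_apply, ← ENNReal.ofReal_one]
                exact ENNReal.ofReal_le_ofReal ((one_le_div hv).2 hk.le)
              · rw [Set.indicator_of_notMem (by exact hk)]; exact zero_le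
          _ = ENNReal.ofReal (∑ k ∈ S, d ^ 2 * (π.count (J k) τ ω : ℝ) / v) :=
              (ENNReal.ofReal_sum_of_nonneg fun k _ => by positivity).symm
          _ ≤ ENNReal.ofReal (d ^ 2 * τ / v) := by
              refine ENNReal.ofReal_le_ofReal ?_
              rw [← Finset.sum_div, ← Finset.mul_sum]
              have h1 : ∑ k ∈ S, (π.count (J k) τ ω : ℝ) ≤ τ := by
                exact_mod_cast π.sum_count_le S hJ τ ω
              gcongr
    _ = _ := by simp

/-- Finding in which of many disjoint regions the unknown function departs from `h` is costly,
when the expected answer is unlikely under `h`. -/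
theorem IsCorrect.exists_expectedBudget_ge {π : CPAlgorithm m} {δ η : ℝ} (hπ : π.IsCorrect δ η)
    (hδ : δ ∈ Set.Ioo (0 : ℝ) (1 / 16)) {K : ℕ} (hK : 0 < K) {μ : Fin K → CPEnvironment m}
    (hμ : ∀ k, (μ k).noise = gaussianReal 0 1) {h : unitInterval → ℝ} (hh : Measurable h)
    {J : Fin K → Set unitInterval} (hJm : ∀ k, MeasurableSet (J k))
    (hJ : Pairwise (Function.onFun Disjoint J)) {d : ℝ} (hd0 : d ≠ 0) (hd1 : d ^ 2 ≤ 1)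
    (hgh : ∀ k, ∀ x ∉ J k, (μ k).mean x = h x) (hd : ∀ k x, ((μ k).mean x - h x) ^ 2 ≤ d ^ 2)
    {A : ℕ → Set π.Outcome} (hA : ∀ n, MeasurableSet[π.past n] (A n))
    (hsub : ∀ k n, π.accurate (μ k).pos η n ⊆ A n)
    (hhalf : π.traceLaw h {ω | ∃ n : ℕ, π.duration ω = n ∧ ω ∈ A n} ≤ ENNReal.ofReal (1 / 2)) :
    ∃ k, ENNReal.ofReal (K / (81920 * d ^ 2)) ≤ π.expectedBudget (μ k) := by
  obtain ⟨hδ0, hδ1⟩ := hδ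
  have hd2 : 0 < d ^ 2 := sq_pos_of_ne_zero hd0
  have hKr : (0 : ℝ) < K := by exact_mod_cast hK
  -- This τ makes 10 d² τ at most K/1024, so under h the probabilities of exploring each region
  -- beyond information 1/10 sum to at most K/1024.
  set τ : ℕ := ⌊(K : ℝ) / (10240 * d ^ 2)⌋₊ with hτ
  have hτle : (τ : ℝ) ≤ K / (10240 * d ^ 2) := Nat.floor_le (by positivity)
  have hτlt : (K : ℝ) / (10240 * d ^ 2) < τ + 1 := Nat.lt_floor_add_one _
  have hexp1 : Real.exp (1 / 10) ≤ 9 / 8 := by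
    have h1 := Real.add_one_le_exp (-(1 / 10 : ℝ))
    rw [Real.exp_neg] at h1
    have h2 := Real.exp_pos (1 / 10)
    have h3 := inv_mul_cancel₀ h2.ne'
    nlinarith
  have hexp2 : Real.exp (1 / 10 + d ^ 2) ≤ 4 := by
    rw [Real.exp_add]
    have h1 : Real.exp (d ^ 2) ≤ Real.exp 1 := Real.exp_le_exp.2 hd1
    have h2 := Real.exp_one_lt_d9
    have h3 := Real.exp_pos (d ^ 2)
    nlinarith [Real.exp_pos (1 / 10)]
  have hone : ∀ k, ENNReal.ofReal (15 / 16) ≤ ENNReal.ofReal (25 / 32)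
      + ENNReal.ofReal 32 * π.traceLaw h {ω | 1 / 10 < d ^ 2 * (π.count (J k) τ ω : ℝ)}
      + π.traceLaw (μ k).mean {ω | (τ : ℕ∞) < π.duration ω} := by
    intro k
    -- For λ = 3/2 the two terms are at most 3/4 · 1/2 and e^{1/10}/3 ≤ 3/8, together 3/4, safely
    -- below 15/16. For the crossing event, λ = 64 makes the error term at most 1/32, at the price
    -- of the factor 32 on the probability under h.
    have h1 := π.traceLaw_stopped_le (μ k).measurable_mean hh (hJm k) (hgh k) (hd k) hA
      (v := 1 / 10) (lam := 3 / 2) (by norm_num) (by norm_num)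
    have h2 := π.traceLaw_count_gt_le (μ k).measurable_mean hh (hJm k) (hgh k) (hd k) τ
      (v := 1 / 10) (lam := 64) (by norm_num) (by norm_num)
    have h3 : ENNReal.ofReal (3 / 2 / 2)
        * π.traceLaw h {ω | ∃ n : ℕ, π.duration ω = n ∧ ω ∈ A n}
        + ENNReal.ofReal (Real.exp (1 / 10) / (2 * (3 / 2))) ≤ ENNReal.ofReal (3 / 4) := by
      refine (add_le_add_left (mul_le_mul_right hhalf _) _).trans ?_
      rw [← ENNReal.ofReal_mul (by norm_num),
        ← ENNReal.ofReal_add (by norm_num) (by positivity)]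
      exact ENNReal.ofReal_le_ofReal (by linarith)
    have h4 : ENNReal.ofReal (Real.exp (1 / 10 + d ^ 2) / (2 * 64)) ≤ ENNReal.ofReal (1 / 32) :=
      ENNReal.ofReal_le_ofReal (by linarith)
    -- A success requires an answer in `A` with little exploration of the region, much exploration
    -- of it before τ, or a duration beyond τ.
    have hcover : π.success (μ k).pos η ⊆
        {ω | (∃ n : ℕ, π.duration ω = n ∧ ω ∈ A n)
          ∧ ENNReal.ofReal (d ^ 2) * π.visits (J k) ω ≤ ENNReal.ofReal (1 / 10)}
        ∪ {ω | 1 / 10 < d ^ 2 * (π.count (J k) τ ω : ℝ)}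
        ∪ {ω | (τ : ℕ∞) < π.duration ω} := by
      rintro ω ⟨n, hn, hacc⟩
      by_cases hlt : (τ : ℕ∞) < π.duration ω
      · exact Or.inr hlt
      · left
        by_cases hvis : ENNReal.ofReal (d ^ 2) * π.visits (J k) ω ≤ ENNReal.ofReal (1 / 10)
        · exact Or.inl ⟨⟨n, hn, hsub k n hacc⟩, hvis⟩
        · right
          rw [π.visits_eq_count _ hn, ← ENNReal.ofReal_natCast,
            ← ENNReal.ofReal_mul hd2.le, not_le, ENNReal.ofReal_lt_ofReal_iff_of_nonneg
              (by norm_num)] at hvis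
          have hnτ : n ≤ τ := by
            rw [hn, not_lt] at hlt
            exact_mod_cast hlt
          have h5 : (π.count (J k) n ω : ℝ) ≤ π.count (J k) τ ω := by
            exact_mod_cast π.count_mono (J k) ω hnτ
          exact hvis.trans_le (mul_le_mul_of_nonneg_left h5 hd2.le)
    have h6 := (hπ.le_traceLaw_success (hμ k)).trans ((measure_mono hcover).trans
      ((measure_union_le _ _).trans (add_le_add_left (measure_union_le _ _) _)))
    have h7 : ENNReal.ofReal (15 / 16) ≤ ENNReal.ofReal (1 - δ) :=
      ENNReal.ofReal_le_ofReal (by linarith)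
    refine h7.trans (h6.trans ?_)
    refine add_le_add_left ?_ _
    refine (add_le_add (h1.trans h3) (h2.trans (add_le_add_right h4 _))).trans (le_of_eq ?_)
    have e1 : ENNReal.ofReal (25 / 32) = ENNReal.ofReal (3 / 4) + ENNReal.ofReal (1 / 32) := by
      rw [← ENNReal.ofReal_add (by norm_num) (by norm_num)]; norm_num
    have e2 : (64 / 2 : ℝ) = 32 := by norm_num
    rw [e1, e2]
    ring
  -- Summing over k leaves 15K/16 - 25K/32 - 32K/1024 = K/8 for durations beyond τ.
  have hsum : ENNReal.ofReal (K * (1 / 8)) ≤ ∑ k,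
      π.traceLaw (μ k).mean {ω | (τ : ℕ∞) < π.duration ω} := by
    have h1 := Finset.sum_le_sum fun k (_ : k ∈ Finset.univ) => hone k
    rw [Finset.sum_add_distrib, Finset.sum_add_distrib, ← Finset.mul_sum, Finset.sum_const,
      Finset.sum_const, nsmul_eq_mul, nsmul_eq_mul, Finset.card_univ, Fintype.card_fin,
      ← ENNReal.ofReal_natCast, ← ENNReal.ofReal_mul hKr.le, ← ENNReal.ofReal_mul hKr.le] at h1
    have h2 := π.sum_traceLaw_count_gt_le hh Finset.univ hJm (fun k _ k' _ hkk => hJ hkk) d τ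
      (v := 1 / 10) (by norm_num)
    have h3 : ENNReal.ofReal (d ^ 2 * τ / (1 / 10)) ≤ ENNReal.ofReal (K / 1024) := by
      refine ENNReal.ofReal_le_ofReal ?_
      rw [le_div_iff₀ (by positivity)] at hτle
      linarith
    have h4 : ENNReal.ofReal (K * (25 / 32)) + ENNReal.ofReal 32
        * ∑ k, π.traceLaw h {ω | 1 / 10 < d ^ 2 * (π.count (J k) τ ω : ℝ)}
        ≤ ENNReal.ofReal (K * (13 / 16)) := by
      refine (add_le_add_right (mul_le_mul_right (h2.trans h3) _) _).trans ?_
      rw [← ENNReal.ofReal_mul (by norm_num), ← ENNReal.ofReal_add (by positivity) (by positivity)]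
      exact ENNReal.ofReal_le_ofReal (by linarith)
    have h5 : ENNReal.ofReal (K * (13 / 16)) + ENNReal.ofReal (K * (1 / 8))
        ≤ ENNReal.ofReal (K * (15 / 16)) := by
      rw [← ENNReal.ofReal_add (by positivity) (by positivity)]
      exact ENNReal.ofReal_le_ofReal (by linarith)
    exact (ENNReal.add_le_add_iff_left ENNReal.ofReal_ne_top).1
      (h5.trans (h1.trans (add_le_add_left h4 _)))
  have : Nonempty (Fin K) := ⟨⟨0, hK⟩⟩
  by_contra! hlt
  have h1 := ENNReal.sum_lt_sum_of_nonempty Finset.univ_nonempty fun k _ => hlt k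
  have h2 := Finset.sum_le_sum fun k (_ : k ∈ Finset.univ) =>
    π.natCast_lt_duration_mul_le (hμ k) τ
  rw [← Finset.mul_sum] at h2
  have h3 := (mul_le_mul_right hsum ((τ + 1 : ℕ) : ℝ≥0∞)).trans_lt (h2.trans_lt h1)
  rw [Finset.sum_const, nsmul_eq_mul, Finset.card_univ, Fintype.card_fin,
    ← ENNReal.ofReal_natCast, ← ENNReal.ofReal_natCast, ← ENNReal.ofReal_mul (by positivity),
    ← ENNReal.ofReal_mul (by positivity), ENNReal.ofReal_lt_ofReal_iff_of_nonneg (by positivity)]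
    at h3
  have h4 : (K : ℝ) / (81920 * d ^ 2) = K / (10240 * d ^ 2) * (1 / 8) := by
    field_simp; norm_num
  rw [h4] at h3
  push_cast at h3
  nlinarith

end CPAlgorithm

namespace CPEnvironment

/-- Two change points `i, j` are replaced by a bump of height `d` and width `s` at `x`, left of
`1 / 2`; the others are moved to `[3 / 4, 1)`. -/
theorem exists_bump {q : ℕ} (ν : CPEnvironment (q + 2)) {i j : Fin (q + 2)}
    {e : Fin q → Fin (q + 2)} (he : StrictMono e)
    (hsum : ∀ f : Fin (q + 2) → ℝ, ∑ k, f k = f i + (f j + ∑ l, f (e l)))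
    {d s x : ℝ} (hd0 : 0 < d) (hd1 : d ≤ 1)
    (hd : 1 / d ^ 2 + 1 / d ^ 2 = 1 / ν.jump i ^ 2 + 1 / ν.jump j ^ 2) (hs0 : 0 < s)
    (hs1 : s ≤ 1 / 4) (hs : 1 / (s * d ^ 2) = ν.detectComplexity) (hx : 0 < x)
    (hxs : x + s ≤ 1 / 2) :
    ∃ μ : CPEnvironment (q + 2), μ.noise = gaussianReal 0 1 ∧ μ.pos 0 = x ∧ ν.Comparable μ ∧
      ∀ t : unitInterval, μ.mean t = (if x ≤ t then d else 0) + ((if x + s ≤ t then -d else 0)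
        + ∑ l, if 3 / 4 + ν.pos (e l) / 4 ≤ t then ν.jump (e l) else 0) := by
  have hfar : ∀ l, 3 / 4 < 3 / 4 + ν.pos (e l) / 4 := fun l => by
    linarith [(ν.pos_mem (e l)).1]
  set p : Fin (q + 2) → ℝ :=
    Fin.cons x (Fin.cons (x + s) fun l => 3 / 4 + ν.pos (e l) / 4) with hp
  set D : Fin (q + 2) → ℝ := Fin.cons d (Fin.cons (-d) fun l => ν.jump (e l)) with hD
  have p0 : p 0 = x := rfl
  have p1 : p (Fin.succ 0) = x + s := rfl
  have p2 : ∀ l : Fin q, p l.succ.succ = 3 / 4 + ν.pos (e l) / 4 := fun l => rfl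
  have D0 : D 0 = d := rfl
  have D1 : D (Fin.succ 0) = -d := rfl
  have D2 : ∀ l : Fin q, D l.succ.succ = ν.jump (e l) := fun l => rfl
  have hforall : ∀ {P : Fin (q + 2) → Prop}, P 0 → P (Fin.succ 0) →
      (∀ l : Fin q, P l.succ.succ) → ∀ k, P k := by
    intro P h0 h1 h2 k
    refine Fin.cases h0 (fun k => ?_) k
    exact Fin.cases h1 h2 k
  have hmono : StrictMono p := by
    intro a b
    refine hforall (P := fun a => a < b → p a < p b) ?_ ?_ (fun l => ?_) a
    · refine hforall (P := fun b => 0 < b → p 0 < p b) ?_ ?_ (fun l => ?_) b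
      · intro h; exact absurd h (lt_irrefl _)
      · intro _; rw [p0, p1]; linarith
      · intro _; rw [p0, p2]; linarith [hfar l]
    · refine hforall (P := fun b => Fin.succ 0 < b → p (Fin.succ 0) < p b) ?_ ?_ (fun l => ?_) b
      · intro h; exact absurd h (Fin.not_lt_zero _)
      · intro h; exact absurd h (lt_irrefl _)
      · intro _; rw [p1, p2]; linarith [hfar l]
    · refine hforall (P := fun b => l.succ.succ < b → p l.succ.succ < p b) ?_ ?_ (fun l' => ?_) b
      · intro h; exact absurd h (Fin.not_lt_zero _)
      · intro h
        exact absurd (Fin.succ_lt_succ_iff.1 h) (Fin.not_lt_zero _)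
      · intro h
        have h' : l < l' := Fin.succ_lt_succ_iff.1 (Fin.succ_lt_succ_iff.1 h)
        rw [p2, p2]; linarith [ν.pos_strictMono (he h')]
  have hmem : ∀ k, p k ∈ Set.Ioo (0 : ℝ) 1 := by
    refine hforall ?_ ?_ fun l => ?_
    · rw [p0]; exact ⟨hx, by linarith⟩
    · rw [p1]; exact ⟨by linarith, by linarith⟩
    · rw [p2]; exact ⟨by linarith [hfar l], by linarith [(ν.pos_mem (e l)).2]⟩
  set μ := gaussian p D hmono hmem
    (hforall (by rw [D0]; exact hd0.ne') (by rw [D1]; exact (neg_neg_of_pos hd0).ne)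
      fun l => by rw [D2]; exact ν.jump_ne_zero _)
    (hforall (by rw [D0, abs_of_pos hd0]; exact hd1)
      (by rw [D1, abs_neg, abs_of_pos hd0]; exact hd1)
      fun l => by rw [D2]; exact ν.abs_jump_le_one _) with hμ
  have hμp : μ.pos = p := rfl
  have hμD : μ.jump = D := rfl
  have hm : 1 ≤ q + 2 := by omega
  have hdet := ν.detectComplexity_pos hm
  have hd2 : 0 < d ^ 2 := by positivity
  have hs_le : ∀ k, (k = 0 ∨ k = Fin.succ 0) → s ≤ μ.localSpacing k := by
    rintro k (rfl | rfl)
    · refine (μ.le_localSpacing_iff _ _).2 ⟨by linarith, hforall (fun h => absurd rfl h)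
        (fun _ => ?_) fun l _ => ?_⟩
      · rw [hμp, p0, p1]; exact le_trans (by linarith) (neg_le_abs _)
      · rw [hμp, p0, p2]; exact le_trans (by linarith [hfar l]) (neg_le_abs _)
    · refine (μ.le_localSpacing_iff _ _).2 ⟨by linarith, hforall (fun _ => ?_)
        (fun h => absurd rfl h) fun l _ => ?_⟩
      · rw [hμp, p0, p1]; exact le_trans (by linarith) (le_abs_self _)
      · rw [hμp, p1, p2]; exact le_trans (by linarith [hfar l]) (neg_le_abs _)
  -- Distances among the other points are divided by four. Their distance to the bump is at least
  -- 1/4, which suffices because local spacings never exceed one.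
  have hs_le' : ∀ l : Fin q, 1 / 4 * ν.localSpacing (e l) ≤ μ.localSpacing l.succ.succ := by
    intro l
    have h1 := ν.localSpacing_le_one (e l)
    refine (μ.le_localSpacing_iff _ _).2 ⟨by linarith, hforall (fun _ => ?_) (fun _ => ?_)
      fun l' hl' => ?_⟩
    · rw [hμp, p0, p2]; exact le_trans (by linarith [hfar l]) (le_abs_self _)
    · rw [hμp, p1, p2]; exact le_trans (by linarith [hfar l]) (le_abs_self _)
    · rw [hμp, p2, p2]
      have hne : e l' ≠ e l := fun h => hl' (by rw [he.injective h])
      have h2 := ν.localSpacing_le_abs hne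
      have h3 : 3 / 4 + ν.pos (e l) / 4 - (3 / 4 + ν.pos (e l') / 4)
          = 1 / 4 * (ν.pos (e l) - ν.pos (e l')) := by ring
      rw [h3, abs_mul, abs_of_pos (by norm_num : (0 : ℝ) < 1 / 4)]
      linarith
  have hloc : μ.localizeComplexity (q + 2) = ν.localizeComplexity (q + 2) := by
    rw [localizeComplexity_self, localizeComplexity_self, hsum fun k => 1 / ν.jump k ^ 2, Fin.sum_univ_succ,
      Fin.sum_univ_succ, hμD, D0, D1, neg_sq]
    simp_rw [D2]
    linarith
  refine ⟨μ, rfl, p0, ⟨?_, ?_, ?_, hloc.le⟩, fun t => ?_⟩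
  -- The bump alone realizes the original detection complexity: the local spacing of its left edge
  -- is at most s, and s d² is the least energy of `ν`.
  · refine le_trans ?_ (μ.one_div_energySq_le 0)
    rw [← hs]
    refine one_div_le_one_div_of_le (μ.energySq_pos 0) ?_
    unfold energySq
    rw [hμD, D0]
    refine mul_le_mul_of_nonneg_right ?_ hd2.le
    have h1 : (Fin.succ 0 : Fin (q + 2)) ≠ 0 := Fin.succ_ne_zero _
    have h2 := μ.localSpacing_le_abs h1
    rw [hμp, p0, p1] at h2
    have h3 : x - (x + s) = -s := by ring
    rwa [h3, abs_neg, abs_of_pos hs0] at h2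
  · have hpair : ∀ k, (k = 0 ∨ k = Fin.succ 0) → D k ^ 2 = d ^ 2 →
        1 / μ.energySq k ≤ 4 * ν.detectComplexity := by
      intro k hk hDk
      have : 1 / μ.energySq k ≤ 1 / (s * d ^ 2) := by
        refine one_div_le_one_div_of_le (by positivity) ?_
        unfold energySq
        rw [hμD, hDk]
        exact mul_le_mul_of_nonneg_right (hs_le k hk) hd2.le
      rw [hs] at this
      linarith
    refine μ.detectComplexity_le hm (hforall ?_ ?_ fun l => ?_)
    · exact hpair _ (Or.inl rfl) rfl
    · exact hpair _ (Or.inr rfl) (by rw [D1, neg_sq])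
    · have h1 := ν.one_div_energySq_le (e l)
      have h2 : 1 / μ.energySq l.succ.succ ≤ 1 / (1 / 4 * ν.energySq (e l)) := by
        refine one_div_le_one_div_of_le (mul_pos (by norm_num) (ν.energySq_pos _)) ?_
        unfold energySq
        rw [hμD, D2, ← mul_assoc]
        exact mul_le_mul_of_nonneg_right (hs_le' l) (sq_nonneg _)
      have h3 : 1 / (1 / 4 * ν.energySq (e l)) = 4 * (1 / ν.energySq (e l)) := by
        field_simp
      linarith
  · rw [hloc]; linarith [ν.localizeComplexity_pos hm]
  · unfold mean
    rw [Fin.sum_univ_succ, Fin.sum_univ_succ]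
    exact zero_add _

end CPEnvironment

open CPEnvironment in
/-- The cost of detecting the change point of least energy. -/
theorem CPAlgorithm.IsCorrect.exists_detection_cost {m : ℕ} {π : CPAlgorithm m} {δ η : ℝ}
    (hπ : π.IsCorrect δ η) (hδ : δ ∈ Set.Ioo (0 : ℝ) (1 / 16))
    (hη : η ∈ Set.Ioo (0 : ℝ) (1 / 8)) (hm : 1 ≤ m) (ν : CPEnvironment m)
    (hlarge : 32 * ν.localizeComplexity m < ν.detectComplexity) :
    ∃ ν' : CPEnvironment m, ν.Comparable ν' ∧
      ENNReal.ofReal (1 / 2621440 * ν.detectComplexity) ≤ π.expectedBudget ν' := by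
  obtain ⟨hη0, hη1⟩ := hη
  have hdet := ν.detectComplexity_pos hm
  obtain ⟨i, hi⟩ := ν.exists_detectComplexity_eq hm
  have hDi := ν.jump_sq_pos i
  have hsi := ν.localSpacing_pos i
  have hsi32 : ν.localSpacing i < 1 / 32 := by
    have h1 : 1 / ν.jump i ^ 2 ≤ ν.localizeComplexity m := by
      rw [localizeComplexity_self]
      exact Finset.single_le_sum (f := fun i => 1 / ν.jump i ^ 2)
        (fun i _ => one_div_nonneg.2 (sq_nonneg _)) (Finset.mem_univ i)
    have h2 : 32 * (1 / ν.jump i ^ 2) < 1 / ν.energySq i := by linarith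
    unfold energySq at h2
    rw [mul_one_div, div_lt_div_iff₀ hDi (by positivity)] at h2
    nlinarith
  obtain ⟨j, hji, hj⟩ := ν.exists_abs_eq_localSpacing (by linarith : ν.localSpacing i < 1)
  have hDj := ν.jump_sq_pos j
  -- The neighbour j has local spacing at most that of i but, by minimality of i, no smaller energy;
  -- so its jump is at least as large.
  have hDij : ν.jump i ^ 2 ≤ ν.jump j ^ 2 := by
    have h1 := ν.one_div_energySq_le j
    rw [hi, one_div_le_one_div (ν.energySq_pos j) (ν.energySq_pos i)] at h1
    have h2 := ν.localSpacing_le_abs hji.symm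
    rw [abs_sub_comm, hj] at h2
    unfold energySq at h1
    nlinarith
  obtain ⟨q, rfl⟩ : ∃ q, m = q + 2 := by
    have h1 := i.2
    have h2 := j.2
    have h3 : (i : ℕ) ≠ j := fun h => hji (Fin.ext h.symm)
    exact ⟨m - 2, by omega⟩
  obtain ⟨b, hb⟩ := Fin.exists_succAbove_eq hji
  obtain ⟨e, he, hsum⟩ : ∃ e : Fin q → Fin (q + 2), StrictMono e ∧
      ∀ f : Fin (q + 2) → ℝ, ∑ k, f k = f i + (f j + ∑ l, f (e l)) := by
    refine ⟨fun l => i.succAbove (b.succAbove l),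
      (Fin.strictMono_succAbove i).comp (Fin.strictMono_succAbove b), fun f => ?_⟩
    rw [Fin.sum_univ_succAbove f i, Fin.sum_univ_succAbove (fun k => f (i.succAbove k)) b, hb]
  have hinvj : 1 / ν.jump j ^ 2 ≤ 1 / ν.jump i ^ 2 := one_div_le_one_div_of_le hDi hDij
  have hone : ∀ k, 1 ≤ 1 / ν.jump k ^ 2 := fun k =>
    (one_le_div (ν.jump_sq_pos k)).2 ((sq_le_one_iff_abs_le_one _).2 (ν.abs_jump_le_one k))
  -- The bump has two edges of equal height d; taking for 1/d² the mean of the two inverse squared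
  -- jumps preserves the localization complexity.
  set w := (1 / ν.jump i ^ 2 + 1 / ν.jump j ^ 2) / 2 with hw
  have hw1 : 1 ≤ w := by linarith [hone i, hone j]
  set d := Real.sqrt (1 / w) with hd
  have hd2 : d ^ 2 = 1 / w := Real.sq_sqrt (by positivity)
  have hd0 : 0 < d := Real.sqrt_pos.2 (by positivity)
  have hdsq1 : d ^ 2 ≤ 1 := by rw [hd2]; exact (div_le_one (by linarith)).2 hw1
  have hd1 : d ≤ 1 := by nlinarith
  have hinvd : 1 / d ^ 2 = w := by rw [hd2, one_div_one_div]
  -- The width is chosen so that s d² is the least energy. It is at most the local spacing of i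
  -- because w ≤ 1/Δ_i².
  set s := w / ν.detectComplexity with hs
  have hs0 : 0 < s := by positivity
  have hs32 : s < 1 / 32 := by
    refine lt_of_le_of_lt ?_ hsi32
    rw [hs, div_le_iff₀ hdet, hi]
    unfold energySq
    have : ν.localSpacing i * (1 / (ν.localSpacing i * ν.jump i ^ 2)) = 1 / ν.jump i ^ 2 := by
      field_simp
    rw [this]
    linarith
  have hsd : 1 / (s * d ^ 2) = ν.detectComplexity := by
    rw [hs, hd2]; field_simp
  -- The number of disjoint bumps of width s that fit in a zone of length 1/16. As s < 1/32, the
  -- floor loses at most a factor 2.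
  set K := ⌊1 / (16 * s)⌋₊ with hK
  have hKle : (K : ℝ) * s ≤ 1 / 16 := by
    have h1 : (K : ℝ) ≤ 1 / (16 * s) := Nat.floor_le (by positivity)
    rw [le_div_iff₀ (by positivity)] at h1
    linarith
  have h2le : 2 ≤ 1 / (16 * s) := by rw [le_div_iff₀ (by positivity)]; linarith
  have hKge : 1 / (32 * s) ≤ K := by
    have h1 : 1 / (16 * s) < K + 1 := Nat.lt_floor_add_one _
    have h3 : 1 / (32 * s) = 1 / (16 * s) / 2 := by field_simp; norm_num
    linarith
  have hK0 : 0 < K := by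
    have : (0 : ℝ) < K := lt_of_lt_of_le (by positivity) hKge
    exact_mod_cast this
  set h : unitInterval → ℝ := fun t =>
    ∑ l, if 3 / 4 + ν.pos (e l) / 4 ≤ t then ν.jump (e l) else 0 with hh
  have hhm : Measurable h := Finset.measurable_sum _ fun l _ =>
    Measurable.ite (measurable_subtype_coe measurableSet_Ici) measurable_const measurable_const
  have := π.isProbabilityMeasure_traceLaw hhm
  -- The first estimate lies within η of the zone [a, a + 1/16], which is necessary for success when
  -- the bump starts there.
  set A : ℝ → ℕ → Set π.Outcome := fun a n =>
    {ω | π.estimate n (π.trunc n ω) 0 ∈ Set.Icc (a - η) (a + 1 / 16 + η)} with hA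
  have hAm : ∀ a n, MeasurableSet[π.past n] (A a n) := fun a n =>
    π.measurable_estimate_past n 0 measurableSet_Icc
  set T : ℝ → Set π.Outcome := fun a => {ω | ∃ n : ℕ, π.duration ω = n ∧ ω ∈ A a n} with hT
  have hdisj : Disjoint (T (1 / 16)) (T (7 / 16)) := by
    refine Set.disjoint_left.2 ?_
    rintro ω ⟨n, hn, hn1⟩ ⟨n', hn', hn2⟩
    have : n = n' := by exact_mod_cast hn.symm.trans hn'
    subst this
    have h1 := hn1.2
    have h2 := hn2.1
    linarith
  -- The enlarged zones at 1/16 and 7/16 are disjoint because 2η < 5/16, so they cannot both have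
  -- probability above 1/2 under h.
  have hzone : ∃ a, 0 < a ∧ a ≤ 7 / 16 ∧ π.traceLaw h (T a) ≤ ENNReal.ofReal (1 / 2) := by
    by_contra! hc
    have h1 := hc (1 / 16) (by norm_num) (by norm_num)
    have h2 := hc (7 / 16) (by norm_num) (by norm_num)
    have h3 := ENNReal.add_lt_add h1 h2
    rw [← measure_union hdisj (π.measurableSet_stopped (hAm _)),
      ← ENNReal.ofReal_add (by norm_num) (by norm_num)] at h3
    have h4 : π.traceLaw h (T (1 / 16) ∪ T (7 / 16)) ≤ 1 := prob_le_one
    norm_num at h3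
    exact absurd (h3.trans_le h4) (lt_irrefl _)
  obtain ⟨a, ha0, ha1, haT⟩ := hzone
  have hpos : ∀ k : Fin K, 0 ≤ (k : ℝ) * s ∧ (k : ℝ) * s + s ≤ 1 / 16 := by
    intro k
    have h1 : ((k : ℕ) : ℝ) + 1 ≤ K := by exact_mod_cast k.2
    refine ⟨by positivity, ?_⟩
    nlinarith
  have hex : ∀ k : Fin K, ∃ μ : CPEnvironment (q + 2), μ.noise = gaussianReal 0 1 ∧
      μ.pos 0 = a + k * s ∧ ν.Comparable μ ∧
      ∀ t : unitInterval, μ.mean t = (if a + k * s ≤ t then d else 0)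
        + ((if a + k * s + s ≤ t then -d else 0) + h t) := fun k =>
    ν.exists_bump he hsum hd0 hd1 (by rw [hinvd, hw]; ring) hs0 (by linarith) hsd
      (by linarith [(hpos k).1]) (by linarith [(hpos k).2])
  choose μ hμn hμ0 hμc hμm using hex
  obtain ⟨k, hk⟩ := hπ.exists_expectedBudget_ge hδ hK0 hμn hhm
    (J := fun k => window (a + k * s) (a + k * s + s)) (fun k => measurableSet_window _ _)
    (by
      have hlt : ∀ k k' : Fin K, k < k' → Disjoint (window (a + k * s) (a + k * s + s))
          (window (a + k' * s) (a + k' * s + s)) := by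
        intro k k' hkk
        refine disjoint_window ?_
        have h1 : ((k : ℕ) : ℝ) + 1 ≤ (k' : ℕ) := by exact_mod_cast hkk
        nlinarith
      intro k k' hkk
      rcases lt_or_gt_of_ne hkk with h1 | h1
      · exact hlt k k' h1
      · exact (hlt k' k h1).symm)
    hd0.ne' hdsq1
    (fun k t ht => by
      rw [hμm]
      by_cases h1 : a + k * s ≤ t
      · have h2 : a + k * s + s ≤ t := not_lt.1 fun hc => ht ⟨h1, hc⟩
        rw [if_pos h1, if_pos h2]; ring
      · rw [if_neg h1, if_neg (by linarith)]; ring)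
    (fun k t => by
      rw [hμm, ← add_assoc, add_sub_cancel_right]
      split_ifs <;> simp [sq_nonneg])
    (A := A a) (hAm a)
    (fun k n ω hω => by
      have h1 := hω 0
      rw [hμ0, abs_le] at h1
      exact ⟨by linarith [(hpos k).1], by linarith [(hpos k).2]⟩)
    haT
  refine ⟨μ k, hμc k, le_trans (ENNReal.ofReal_le_ofReal ?_) hk⟩
  have h1 : (1 : ℝ) / 2621440 * ν.detectComplexity = 1 / (32 * s) / (81920 * d ^ 2) := by
    rw [← hsd]; field_simp; norm_num
  rw [h1]
  gcongr

/-! ### Combination of the three costs. -/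

theorem corollary1 :
    ∃ c : ℝ, 0 < c ∧
      ∀ (δ η : ℝ), δ ∈ Set.Ioo (0 : ℝ) (1 / 16) → η ∈ Set.Ioo (0 : ℝ) (1 / 8) →
      ∀ (m : ℕ), 1 ≤ m →
      ∀ (ν : CPEnvironment m), (∀ i : ℕ, 2 ≤ i → i ≤ m - 1 → 2 * η < ν.spacing i) →
      ∀ (π : CPAlgorithm m), π.IsCorrect δ η →
      ∃ ν' : CPEnvironment m,
        ν.detectComplexity ≤ ν'.detectComplexity ∧
        ν'.detectComplexity ≤ 4 * ν.detectComplexity ∧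
        1 / 2 * ν.localizeComplexity m ≤ ν'.localizeComplexity m ∧
        ν'.localizeComplexity m ≤ ν.localizeComplexity m ∧
        ENNReal.ofReal
            (c * (ν.detectComplexity + ν.localizeComplexity m * Real.log (1 / (4 * δ))
              + ∑ i, 1 / ν.jump i ^ 2 * Real.posLog (ν.localSpacing i / (16 * η))))
          ≤ π.expectedBudget ν' := by
  -- Any constant below those of the three cases works: 7/(64 · 256), 1/(4 · 2621440), and 7/16
  -- times a number close to 3/4.
  refine ⟨1 / 67108864, by norm_num, ?_⟩
  intro δ η hδ hη m hm ν hν π hπ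
  set A := ν.detectComplexity
  set B := ν.localizeComplexity m * Real.log (1 / (4 * δ)) with hB
  set C := ∑ i, 1 / ν.jump i ^ 2 * Real.posLog (ν.localSpacing i / (16 * η))
  have hA0 : 0 < A := ν.detectComplexity_pos hm
  have hH0 : 0 < ν.localizeComplexity m := ν.localizeComplexity_pos hm
  have hC0 : 0 ≤ C := Finset.sum_nonneg fun i _ =>
    mul_nonneg (one_div_nonneg.2 (sq_nonneg _)) Real.posLog_nonneg
  have hlog : 1 ≤ Real.log (1 / (4 * δ)) := by
    have h4 : 4 ≤ 1 / (4 * δ) := by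
      rw [le_div_iff₀ (by linarith [hδ.1])]
      linarith [hδ.2]
    rw [Real.le_log_iff_exp_le (by linarith)]
    linarith [Real.exp_one_lt_d9]
  have hHB : ν.localizeComplexity m ≤ B := le_mul_of_one_le_right hH0.le hlog
  suffices h : ∃ ν' : CPEnvironment m, ν.Comparable ν' ∧
      ENNReal.ofReal (1 / 67108864 * (A + B + C)) ≤ π.expectedBudget ν' by
    obtain ⟨ν', hc, hE⟩ := h
    exact ⟨ν', hc.detect_le, hc.le_detect, hc.le_localize, hc.localize_le, hE⟩
  by_cases hBX : A + B + C ≤ 256 * B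
  · obtain ⟨ν', hc, hE⟩ := hπ.exists_confidence_cost hδ hη hm ν hν
    exact ⟨ν', hc, (ENNReal.ofReal_le_ofReal (by linarith)).trans hE⟩
  -- Here B is below 1/256 of the total, so if `A` is at least a quarter of it, then 32 times the
  -- localization complexity, at most 32B, is smaller than `A`, as the detection bound requires.
  by_cases hAX : A + B + C ≤ 4 * A
  · obtain ⟨ν', hc, hE⟩ := hπ.exists_detection_cost hδ hη hm ν (by linarith)
    exact ⟨ν', hc, (ENNReal.ofReal_le_ofReal (by linarith)).trans hE⟩
  -- Now `C` exceeds (3/4 - 1/256) of the total, so subtracting `B` in the search cost is harmless.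
  · obtain ⟨ν', hc, hE⟩ := hπ.exists_search_cost hδ hη.1 hm ν
    exact ⟨ν', hc, (ENNReal.ofReal_le_ofReal (by linarith)).trans hE⟩
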